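/- Write $e(z)=\exp(2\pi i z)$ and let $\mathbb H$ be the upper half plane. Let $\mathrm{Mp}_1(\mathbb Z)$ be the group of pairs $(\gamma,\omega)$ with $\gamma=\begin{pmatrix}a&b\\c&d\end{pmatrix}\in\mathrm{SL}_2(\mathbb Z)$ and $\omega:\mathbb H\to\mathbb C$ holomorphic with $\omega(\tau)^2=c\tau+d$, with product $(\gamma_1,\omega_1)(\gamma_2,\omega_2)=(\gamma_1\gamma_2,(\omega_1\circ\gamma_2)\,\omega_2)$; we also write $\gamma$ for $(\gamma,\omega)$. Let $T=(\begin{pmatrix}1&1\\0&1\end{pmatrix},1)$, and let $\widetilde\Gamma_0(\ell)$ be the subgroup of $\mathrm{Mp}_1(\mathbb Z)$ defined by $\ell\mid c$. Let $\Gamma\subseteq\mathrm{Mp}_1(\mathbb Z)$ be a subgroup of finite index with $T\in\Gamma$, let $\chi:\Gamma\to\mathbb C^\times$ be a character, and let $\beta\in\mathbb Q$ with $\chi(T)=e(\beta)$. View $\chi$ as a character of $\Gamma\ltimes \mathrm H(\mathbb Z)$, where $\mathrm H(\mathbb Z)$ is the Heisenberg group, by letting it be trivial on $\mathrm H(\mathbb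 Z)$. *Modular forms.* A weakly holomorphic modular form of weight $k\in\frac12\mathbb Z$ for $\chi$ is a holomorphic $f:\mathbb H\to\mathbb C$ such that, with $(f|_k(\gamma,\omega))(\tau)=\omega(\tau)^{-2k}f(\gamma\tau)$, one has $f|_k\gamma=\chi(\gamma)f$ for all $\gamma\in\Gamma$, and for which there is $a\in\mathbb R$ with $|(f|_k\gamma)(\tau)|\ll\exp(a\,\mathrm{Im}\,\tau)$ as $\mathrm{Im}\,\tau\to\infty$ for all $\gamma\in\mathrm{Mp}_1(\mathbb Z)$. *Jacobi forms.* Let $k\in\frac12\mathbb Z$, $m\in\mathbb C$, and $$(\phi|_{k,m}(\gamma,\omega))(\tau,z)=\omega(\tau)^{-2k}\,e\Big(\frac{-mcz^2}{c\tau+d}\Big)\,\phi\Big(\frac{a\tau+b}{c\tau+d},\frac{z}{c\tau+d}\Big),$$ $$(\phi|_{k,m}(\lambda,\mu,\kappa))(\tau,z)=e\big(m(\lambda^2\tau+2\lambda z+\kappa)\big)\,\phi(\tau,z+\lambda\tau+\mu).$$ Let $\phi$ be a weakly holomorphic Jacobi form of weight $k$ and index $m$ for $\chi$ with possible singularities at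 $\mathbb Z+\tau\mathbb Z$. That is, $\phi$ is a meromorphic function on $\mathbb H\times\mathbb C$ that is holomorphic where $z\notin\mathbb Z+\tau\mathbb Z$, satisfies $\phi|_{k,m}\gamma=\chi(\gamma)\phi$ for $\gamma\in\Gamma$ and $\phi|_{k,m}(\lambda,\mu,\kappa)=\phi$ for $\lambda,\mu,\kappa\in\mathbb Z$, and has the following growth: for every $\gamma\in\mathrm{Mp}_1(\mathbb Z)$ and $\lambda\in\mathbb Q$ there is $a\in\mathbb R$ such that for all $\mu\in\mathbb Q$ with $(\lambda,\mu)\notin\mathbb Z^2$, $|(\phi|_{k,m}\gamma)(\tau,\lambda\tau+\mu)|\ll\exp(a\,\mathrm{Im}\,\tau)$ as $\mathrm{Im}\,\tau\to\infty$. *Explained congruences.* Let $\ell$ be a prime number, $K\subset\mathbb C$ a number field, $\mathfrak l$ a prime ideal of $\mathcal O_K$ containing $\ell$, and $M$ a positive integer. For $\beta'\in\mathbb Q$ we say that $\phi$ explains a Ramanujan-type congruence modulo $\ell$ on $M\mathbb Z+\beta'$ if the following hold. * $\phi$ specializes to a weakly holomorphic modular form: for some $\nu\in\mathbb Z$, the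 limits $f(\tau)=\lim_{z\to0}(e(\frac z2)-e(-\frac z2))^{\nu}\phi(\tau,z)$ exist for all $\tau\in\mathbb H$, and $f$ is not identically zero and is a weakly holomorphic modular form of weight $k-\nu$ for $\chi$. (So $-\nu$ is the order of $\phi$ at $z=0$.) * $\phi$ has a Fourier expansion $\phi(\tau,z)=\sum_{n,r\in\mathbb Q}c(\phi;n,r)e(n\tau+rz)$, valid for positive and sufficiently small $\mathrm{Im}(z)/\mathrm{Im}(\tau)$, with all coefficients $c(\phi;n,r)$ in the localization $\mathcal O_{K,\mathfrak l}\subset\mathbb C$. * For every $n\in M\mathbb Z+\beta'$ the leading Fourier coefficient $$\tilde c(\phi;n;z)=\big(e(\tfrac z2)-e(-\tfrac z2)\big)^{\nu}\sum_{r\in\mathbb Q}c(\phi;n,r)e(rz)$$ is, for some positive integer $N$, a Laurent polynomial in $e(z/N)$ that is divisible, in the ring of such Laurent polynomials, by the $\ell$-th cyclotomic polynomial in $e(z)$. *The group $\Gamma^\Delta_M(\chi)$.* Let $\delta_M=\begin{pmatrix}1&0\\0&M\end{pmatrix}$, lifted to $(\delta_M,\sqrt M)$. An element $(\gamma,\omega)$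 of $\mathrm{Mp}_1(\mathbb Z)$ lies in $\delta_M^{-1}\Gamma\delta_M$ if and only if $M\mid b$ and $$\iota(\gamma,\omega)=\delta_M(\gamma,\omega)\delta_M^{-1}=\Big(\begin{pmatrix}a&b/M\\Mc&d\end{pmatrix},\ \tau\mapsto\omega(M\tau)\Big)\in\Gamma,$$ and then we put $\widetilde\chi(\gamma,\omega)=\chi(\iota(\gamma,\omega))$. Let $\Gamma^\Delta_M(\chi)$ be the set of all $\gamma=\begin{pmatrix}a&b\\c&d\end{pmatrix}\in\Gamma$ that are diagonal modulo $M$ and satisfy, for all $h\in\mathbb Z$, both $T^{a^2h}\gamma T^{-h}\in\delta_M^{-1}\Gamma\delta_M$ and $\widetilde\chi(T^{a^2h}\gamma T^{-h})=\widetilde\chi(\gamma)$. **Theorem.** If $\phi$ explains a Ramanujan-type congruence modulo $\ell$ on $M\mathbb Z+\beta$, then it explains a Ramanujan-type congruence modulo $\ell$ on $M\mathbb Z+a^2\beta$ for all $a\in\mathbb Z$ such that there is $\begin{pmatrix}a&b\\c&d\end{pmatrix}\in\Gamma^\Delta_M(\chi)\cap\widetilde\Gamma_0(\ell)$. -/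

import Mathlib

open scoped MatrixGroups Manifold Topology LaurentPolynomial NumberField
open UpperHalfPlane Filter

noncomputable section

namespace JacobiRC

/-- The normalized exponential `e(z) = exp(2πi z)`. -/
def e (z : ℂ) : ℂ := Complex.exp (2 * Real.pi * Complex.I * z)

theorem e_ne_zero (z : ℂ) : e z ≠ 0 := Complex.exp_ne_zero _

/-! ### The metaplectic group -/

/-- The metaplectic group `Mp₁(ℤ)`: pairs of a matrix in `SL(2, ℤ)` with bottom row `(c, d)` and a
holomorphic square root `ω` of `c τ + d` on the upper half plane. -/
@[ext]
structure Mp1Z where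
  mat : SL(2, ℤ)
  root : ℍ → ℂ
  holo : MDifferentiable 𝓘(ℂ) 𝓘(ℂ) root
  sq : ∀ τ : ℍ, root τ ^ 2 = (mat 1 0 : ℂ) * τ + (mat 1 1 : ℂ)

namespace Mp1Z

/-- The factor `c τ + d`. -/
def den (x : Mp1Z) (τ : ℍ) : ℂ := (x.mat 1 0 : ℂ) * τ + (x.mat 1 1 : ℂ)

theorem denom_mapGL (g : SL(2, ℤ)) (τ : ℍ) :
    denom (Matrix.SpecialLinearGroup.mapGL ℝ g) τ = (g 1 0 : ℂ) * τ + (g 1 1 : ℂ) := by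
  simp [denom]

theorem den_ne_zero (g : SL(2, ℤ)) (τ : ℍ) : (g 1 0 : ℂ) * τ + (g 1 1 : ℂ) ≠ 0 := by
  rw [← denom_mapGL]
  exact denom_ne_zero _ τ

theorem root_ne_zero (x : Mp1Z) (τ : ℍ) : x.root τ ≠ 0 := by
  intro h
  have := x.sq τ
  rw [h] at this
  exact den_ne_zero x.mat τ (by rw [← this]; simp)

theorem den_cocycle (g h : SL(2, ℤ)) (τ : ℍ) :
    ((g * h) 1 0 : ℂ) * τ + ((g * h) 1 1 : ℂ) =
      ((g 1 0 : ℂ) * (h • τ : ℍ) + (g 1 1 : ℂ)) * ((h 1 0 : ℂ) * τ + (h 1 1 : ℂ)) := by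
  rw [coe_specialLinearGroup_apply]
  have := den_ne_zero h τ
  simp only [algebraMap_int_eq, eq_intCast, Complex.ofReal_intCast,
    Matrix.SpecialLinearGroup.coe_mul, Matrix.mul_apply, Fin.sum_univ_two, Int.cast_add,
    Int.cast_mul]
  generalize (g 1 0 : ℂ) = p, (g 1 1 : ℂ) = q at *
  field_simp
  ring

theorem mdifferentiable_sl_smul (g : SL(2, ℤ)) :
    MDifferentiable 𝓘(ℂ) 𝓘(ℂ) (fun τ : ℍ ↦ g • τ) :=
  mdifferentiable_smul (g := Matrix.SpecialLinearGroup.mapGL ℝ g) (by simp)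

/-- `(γ₁, ω₁) (γ₂, ω₂) = (γ₁ γ₂, (ω₁ ∘ γ₂) · ω₂)`. -/
instance : Mul Mp1Z where
  mul x y :=
    { mat := x.mat * y.mat
      root := fun τ ↦ x.root (y.mat • τ) * y.root τ
      holo := (x.holo.comp (mdifferentiable_sl_smul y.mat)).mul y.holo
      sq := fun τ ↦ by rw [mul_pow, x.sq, y.sq, den_cocycle] }

instance : One Mp1Z where
  one :=
    { mat := 1
      root := fun _ ↦ 1
      holo := mdifferentiable_const
      sq := fun τ ↦ by simp }

instance : Inv Mp1Z where
  inv x :=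
    { mat := x.mat⁻¹
      root := fun τ ↦ (x.root (x.mat⁻¹ • τ))⁻¹
      holo := by
        have h := x.holo.comp (mdifferentiable_sl_smul x.mat⁻¹)
        rw [mdifferentiable_iff] at h ⊢
        exact h.inv fun z _ ↦ root_ne_zero _ _
      sq := fun τ ↦ by
        have h := den_cocycle x.mat x.mat⁻¹ τ
        rw [← x.sq, mul_inv_cancel] at h
        rw [inv_pow]
        refine (eq_inv_of_mul_eq_one_right ?_).symm
        rw [← h]
        simp }

@[simp] theorem mul_mat (x y : Mp1Z) : (x * y).mat = x.mat * y.mat := rfl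
@[simp] theorem mul_root (x y : Mp1Z) (τ : ℍ) :
    (x * y).root τ = x.root (y.mat • τ) * y.root τ := rfl
@[simp] theorem one_mat : (1 : Mp1Z).mat = 1 := rfl
@[simp] theorem one_root (τ : ℍ) : (1 : Mp1Z).root τ = 1 := rfl
@[simp] theorem inv_mat (x : Mp1Z) : (x⁻¹).mat = x.mat⁻¹ := rfl
@[simp] theorem inv_root (x : Mp1Z) (τ : ℍ) :
    (x⁻¹).root τ = (x.root (x.mat⁻¹ • τ))⁻¹ := rfl

instance : Group Mp1Z :=
  Group.ofLeftAxioms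
    (fun x y z ↦ by
      ext1
      · simp [mul_assoc]
      · funext τ
        simp [mul_assoc, mul_smul])
    (fun x ↦ by
      ext1
      · simp
      · funext τ
        simp)
    (fun x ↦ by
      ext1
      · simp
      · funext τ
        simp [root_ne_zero])

/-- The translation `T = ((1, 1; 0, 1), 1)`. -/
def T : Mp1Z where
  mat := ModularGroup.T
  root := fun _ ↦ 1
  holo := mdifferentiable_const
  sq := fun τ ↦ by simp [ModularGroup.T]

end Mp1Z

/-- The preimage in `Mp₁(ℤ)` of `Γ₀(ℓ)`. -/
def mpGamma0 (ℓ : ℕ) : Subgroup Mp1Z where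
  carrier := {x | (ℓ : ℤ) ∣ x.mat 1 0}
  mul_mem' {x y} hx hy := by
    simp only [Set.mem_ofPred_eq] at hx hy ⊢
    have : (x * y).mat 1 0 = x.mat 1 0 * y.mat 0 0 + x.mat 1 1 * y.mat 1 0 := by
      simp [Matrix.SpecialLinearGroup.coe_mul, Matrix.mul_apply, Fin.sum_univ_two]
    rw [this]
    exact dvd_add (hx.mul_right _) (hy.mul_left _)
  one_mem' := by simp
  inv_mem' {x} hx := by
    simpa [Matrix.SpecialLinearGroup.SL2_inv_expl] using hx

/-- The preimage in `Mp₁(ℤ)` of `Γ⁰(M)`. -/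
def mpGammaUpper0 (M : ℕ) : Subgroup Mp1Z where
  carrier := {x | (M : ℤ) ∣ x.mat 0 1}
  mul_mem' {x y} hx hy := by
    simp only [Set.mem_ofPred_eq] at hx hy ⊢
    have : (x * y).mat 0 1 = x.mat 0 0 * y.mat 0 1 + x.mat 0 1 * y.mat 1 1 := by
      simp [Matrix.SpecialLinearGroup.coe_mul, Matrix.mul_apply, Fin.sum_univ_two]
    rw [this]
    exact dvd_add (hy.mul_left _) (hx.mul_right _)
  one_mem' := by simp
  inv_mem' {x} hx := by
    simpa [Matrix.SpecialLinearGroup.SL2_inv_expl] using hx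

theorem mem_mpGammaUpper0 {M : ℕ} {x : Mp1Z} :
    x ∈ mpGammaUpper0 M ↔ (M : ℤ) ∣ x.mat 0 1 := Iff.rfl

/-- The point `M τ` of the upper half plane. -/
def scale (M : ℕ+) (τ : ℍ) : ℍ :=
  ⟨(M : ℂ) * τ, by
    have : (0 : ℝ) < (M : ℕ) := by exact_mod_cast M.pos
    simpa using mul_pos this τ.im_pos⟩

theorem coe_scale (M : ℕ+) (τ : ℍ) : (scale M τ : ℂ) = (M : ℂ) * τ := rfl

theorem mdifferentiable_scale (M : ℕ+) : MDifferentiable 𝓘(ℂ) 𝓘(ℂ) (scale M) := by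
  have h : scale M = fun τ : ℍ ↦ ofComplex ((M : ℂ) * (τ : ℂ)) := by
    funext τ
    rw [← coe_scale, ofComplex_apply]
  rw [h]
  intro τ
  refine MDifferentiableAt.comp (I' := 𝓘(ℂ)) τ (g := ofComplex)
    (f := fun τ : ℍ ↦ (M : ℂ) * (τ : ℂ)) ?_ ?_
  · exact mdifferentiableAt_ofComplex (scale M τ).im_pos
  · exact (mdifferentiable_const (c := (M : ℂ))).mul mdifferentiable_coe τ

/-- The matrix `δ_M g δ_M⁻¹ = (a, b / M; M c, d)`, where `δ_M = diag(1, M)` and `M ∣ b`. -/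
def heckeMat (M : ℕ+) (g : SL(2, ℤ)) (hg : (M : ℤ) ∣ g 0 1) : SL(2, ℤ) :=
  ⟨!![g 0 0, g 0 1 / (M : ℤ); (M : ℤ) * g 1 0, g 1 1], by
    have h := Matrix.SpecialLinearGroup.det_coe g
    rw [Matrix.det_fin_two] at h
    rw [Matrix.det_fin_two_of, ← mul_assoc, Int.ediv_mul_cancel hg]
    exact h⟩

theorem coe_heckeMat (M : ℕ+) (g : SL(2, ℤ)) (hg : (M : ℤ) ∣ g 0 1) :
    (heckeMat M g hg : Matrix (Fin 2) (Fin 2) ℤ) =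
      !![g 0 0, g 0 1 / (M : ℤ); (M : ℤ) * g 1 0, g 1 1] := rfl

theorem heckeMat_mul (M : ℕ+) (g h : SL(2, ℤ)) (hg : (M : ℤ) ∣ g 0 1) (hh : (M : ℤ) ∣ h 0 1)
    (hgh : (M : ℤ) ∣ (g * h) 0 1) :
    heckeMat M (g * h) hgh = heckeMat M g hg * heckeMat M h hh := by
  have hM : (M : ℤ) ≠ 0 := by exact_mod_cast M.ne_zero
  apply Subtype.ext
  rw [Matrix.SpecialLinearGroup.coe_mul, coe_heckeMat, coe_heckeMat, coe_heckeMat]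
  obtain ⟨u, hu⟩ := hg
  obtain ⟨v, hv⟩ := hh
  have hw : (g * h) 0 1 = (M : ℤ) * (g 0 0 * v + u * h 1 1) := by
    simp only [Matrix.SpecialLinearGroup.coe_mul, Matrix.mul_apply, Fin.sum_univ_two, hu, hv]
    ring
  rw [hw, hu, hv, Int.mul_ediv_cancel_left _ hM, Int.mul_ediv_cancel_left _ hM,
    Int.mul_ediv_cancel_left _ hM, Matrix.mul_fin_two]
  simp only [Matrix.SpecialLinearGroup.coe_mul, Matrix.mul_apply, Fin.sum_univ_two, hu, hv]
  congr! 3 <;> ring_nf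

theorem scale_heckeMat_smul (M : ℕ+) (g : SL(2, ℤ)) (hg : (M : ℤ) ∣ g 0 1) (τ : ℍ) :
    scale M (heckeMat M g hg • τ) = g • scale M τ := by
  have hMZ : (M : ℤ) ≠ 0 := by exact_mod_cast M.ne_zero
  apply UpperHalfPlane.ext
  rw [coe_scale, coe_specialLinearGroup_apply, coe_specialLinearGroup_apply, coe_scale]
  simp only [coe_heckeMat]
  obtain ⟨u, hu⟩ := hg
  rw [hu, Int.mul_ediv_cancel_left _ hMZ]
  simp
  ring

/-- The embedding `(γ, ω) ↦ ((a, b / M; M c, d), τ ↦ ω(M τ))` of the preimage of `Γ⁰(M)` into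
`Mp₁(ℤ)`, that is, conjugation `x ↦ δ_M x δ_M⁻¹` by the lift of `δ_M = diag(1, M)`. -/
def iotaHecke (M : ℕ+) : mpGammaUpper0 M →* Mp1Z where
  toFun x :=
    { mat := heckeMat M x.1.mat (mem_mpGammaUpper0.1 x.2)
      root := fun τ ↦ x.1.root (scale M τ)
      holo := x.1.holo.comp (mdifferentiable_scale M)
      sq := fun τ ↦ by
        rw [x.1.sq, coe_scale]
        simp [heckeMat]
        ring }
  map_one' := by
    ext1
    · apply Subtype.ext
      simp [coe_heckeMat, Matrix.one_fin_two]
    · rfl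
  map_mul' x y := by
    ext1
    · exact heckeMat_mul M x.1.mat y.1.mat x.2 y.2 (x * y).2
    · funext τ
      change x.1.root (y.1.mat • scale M τ) * y.1.root (scale M τ) =
        x.1.root (scale M (heckeMat M y.1.mat (mem_mpGammaUpper0.1 y.2) • τ)) * y.1.root (scale M τ)
      rw [scale_heckeMat_smul]

/-! ### The groups `Γ_M^Δ` and `Γ_M^Δ(χ)` -/

/-- The group `δ_M⁻¹ Γ δ_M ∩ Mp₁(ℤ)`, as a subgroup of the preimage of `Γ⁰(M)`. -/
abbrev heckeGroup (M : ℕ+) (Γ : Subgroup Mp1Z) : Subgroup (mpGammaUpper0 M) :=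
  Γ.comap (iotaHecke M)

/-- The character `χ̃`, the pullback of `χ` along `iotaHecke M`. -/
def chiTilde (M : ℕ+) (Γ : Subgroup Mp1Z) (χ : Γ →* ℂˣ) : heckeGroup M Γ →* ℂˣ :=
  χ.comp ((iotaHecke M).subgroupComap Γ)

/-- The element `T ^ (a² h) γ T ^ (-h)`, where `a` is the upper left entry of `γ`. -/
def twist (γ : Mp1Z) (h : ℤ) : Mp1Z := Mp1Z.T ^ (γ.mat 0 0 ^ 2 * h) * γ * Mp1Z.T ^ (-h)

/-- `Γ_M^Δ`: the elements `γ` of `Γ` that are diagonal modulo `M` and for which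
`T ^ (a² h) γ T ^ (-h)` lies in `δ_M⁻¹ Γ δ_M` for all integers `h`. -/
def gammaDelta (M : ℕ+) (Γ : Subgroup Mp1Z) : Set Mp1Z :=
  {γ | γ ∈ Γ ∧ (∀ h : ℤ, twist γ h ∈ (heckeGroup M Γ).map (mpGammaUpper0 M).subtype) ∧
    (M : ℤ) ∣ γ.mat 0 1 ∧ (M : ℤ) ∣ γ.mat 1 0}

/-- `Γ_M^Δ(χ)`: the elements `γ` of `Γ_M^Δ` with `χ̃(T ^ (a² h) γ T ^ (-h)) = χ̃(γ)` for all
integers `h`. -/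
def gammaDeltaChar (M : ℕ+) (Γ : Subgroup Mp1Z) (χ : Γ →* ℂˣ) : Set Mp1Z :=
  {γ | γ ∈ gammaDelta M Γ ∧ ∀ (h : ℤ) (x y : heckeGroup M Γ),
    (x : Mp1Z) = twist γ h → (y : Mp1Z) = γ → chiTilde M Γ χ x = chiTilde M Γ χ y}

/-! ### Weakly holomorphic modular forms -/

/-- The slash action of weight `w / 2`, where `w` is an integer. -/
def slash (w : ℤ) (f : ℍ → ℂ) (x : Mp1Z) : ℍ → ℂ :=
  fun τ ↦ x.root τ ^ (-w) * f (x.mat • τ)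

/-- Weakly holomorphic modular forms of weight `w / 2` for the character `χ` of `Γ`. -/
structure IsWeaklyHolomorphicModularForm (Γ : Subgroup Mp1Z) (χ : Γ →* ℂˣ) (w : ℤ)
    (f : ℍ → ℂ) : Prop where
  holo : MDifferentiable 𝓘(ℂ) 𝓘(ℂ) f
  slash_eq : ∀ (γ : Γ) (τ : ℍ), slash w f γ τ = (χ γ : ℂ) * f τ
  growth : ∃ a : ℝ, ∀ x : Mp1Z, slash w f x =O[atImInfty] fun τ : ℍ ↦ Real.exp (a * τ.im)

/-! ### Weakly holomorphic Jacobi forms with singularities at lattice points -/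

/-- The Jacobi slash action of `Mp₁(ℤ)` of weight `w / 2` and index `m`. -/
def jacobiSlash (w : ℤ) (m : ℂ) (φ : ℍ → ℂ → ℂ) (x : Mp1Z) : ℍ → ℂ → ℂ :=
  fun τ z ↦ x.root τ ^ (-w) * e (m * (-(x.mat 1 0 : ℂ) * z ^ 2 / x.den τ)) *
    φ (x.mat • τ) (z / x.den τ)

/-- The Jacobi slash action of the element `(l, u, κ)` of the Heisenberg group `H(ℤ)`. -/
def heisenbergSlash (m : ℂ) (φ : ℍ → ℂ → ℂ) (l u κ : ℤ) : ℍ → ℂ → ℂ :=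
  fun τ z ↦ e (m * ((l : ℂ) ^ 2 * τ + 2 * l * z + κ)) * φ τ (z + l * τ + u)

/-- The lattice `ℤ + τ ℤ`. -/
def lattice (τ : ℂ) : Set ℂ := {z | ∃ l u : ℤ, z = l * τ + u}

/-- A function of two complex variables is meromorphic at a point if near this point it is a
quotient `g / h` of analytic functions with `h` not vanishing identically. Since values of a
meromorphic function at its singularities are irrelevant, the quotient is compared to the function
only where `h` does not vanish. -/
def IsMeromorphicAt (F : ℂ × ℂ → ℂ) (p : ℂ × ℂ) : Prop :=
  ∃ g h : ℂ × ℂ → ℂ, AnalyticAt ℂ g p ∧ AnalyticAt ℂ h p ∧ (∃ᶠ q in 𝓝 p, h q ≠ 0) ∧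
    ∀ᶠ q in 𝓝 p, h q ≠ 0 → F q = g q / h q

/-- Weakly holomorphic Jacobi forms of weight `w / 2` and index `m` with possible singularities at
`ℤ + τ ℤ` for a character `χ` of `Γ`, viewed as a character of `Γ ⋉ H(ℤ)` that is trivial on `H(ℤ)`.
Such a form is a meromorphic function, represented by a function `φ` whose values at `ℤ + τ ℤ` are
irrelevant. -/
structure IsJacobiForm (Γ : Subgroup Mp1Z) (χ : Γ →* ℂˣ) (w : ℤ) (m : ℂ)
    (φ : ℍ → ℂ → ℂ) : Prop where
  mero : ∀ p : ℂ × ℂ, 0 < p.1.im → IsMeromorphicAt (fun q ↦ φ (ofComplex q.1) q.2) p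
  holo : DifferentiableOn ℂ (fun q : ℂ × ℂ ↦ φ (ofComplex q.1) q.2)
    {q | 0 < q.1.im ∧ q.2 ∉ lattice q.1}
  slash_eq : ∀ (γ : Γ) (τ : ℍ) (z : ℂ), z ∉ lattice τ →
    jacobiSlash w m φ γ τ z = (χ γ : ℂ) * φ τ z
  heisenberg_eq : ∀ (l u κ : ℤ) (τ : ℍ) (z : ℂ), z ∉ lattice τ →
    heisenbergSlash m φ l u κ τ z = φ τ z
  growth : ∀ (x : Mp1Z) (l : ℚ), ∃ a : ℝ, ∀ u : ℚ, (¬ ∃ l' u' : ℤ, l = l' ∧ u = u') →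
    (fun τ : ℍ ↦ jacobiSlash w m φ x τ (l * τ + u)) =O[atImInfty]
      fun τ : ℍ ↦ Real.exp (a * τ.im)

/-! ### Explainable Ramanujan-type congruences -/

/-- `c` is the family of Fourier coefficients of `φ`: the expansion
`φ(τ, z) = ∑ c(n, r) e(n τ + r z)` is valid for positive and sufficiently small `Im z / Im τ`. -/
def IsFourierExpansion (φ : ℍ → ℂ → ℂ) (c : ℚ → ℚ → ℂ) : Prop :=
  ∃ ε : ℝ, 0 < ε ∧ ∀ (τ : ℍ) (z : ℂ), 0 < z.im → z.im < ε * τ.im →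
    HasSum (fun p : ℚ × ℚ ↦ c p.1 p.2 * e (p.1 * τ + p.2 * z)) (φ τ z)

/-- The function `e(z / 2) - e(-z / 2)`. -/
def thetaFactor (z : ℂ) : ℂ := e (z / 2) - e (-z / 2)

/-- `φ` has order `-ν` at `z = 0` and its leading Laurent coefficient there, with respect to
`e(z / 2) - e(-z / 2)`, equals `f`. -/
def SpecializesTo (φ : ℍ → ℂ → ℂ) (ν : ℤ) (f : ℍ → ℂ) : Prop :=
  (∀ τ : ℍ, Tendsto (fun z ↦ thetaFactor z ^ ν * φ τ z) (𝓝[≠] 0) (𝓝 (f τ))) ∧ f ≠ 0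

/-- The leading Fourier coefficient `c̃(φ; n; z) = (e(z / 2) - e(-z / 2)) ^ ν ∑ c(n, r) e(r z)`,
where `Im z > 0`. -/
def leadingCoeff (c : ℚ → ℚ → ℂ) (ν : ℤ) (n : ℚ) (z : ℍ) : ℂ :=
  thetaFactor z ^ ν * ∑' r : ℚ, c n r * e (r * z)

/-- A Laurent polynomial evaluated at `e(w)`. -/
def evalE (P : ℂ[T;T⁻¹]) (w : ℂ) : ℂ :=
  LaurentPolynomial.eval₂ (RingHom.id ℂ) (Units.mk0 (e w) (e_ne_zero w)) P

/-- For some positive integer `N`, the function `F` is a Laurent polynomial in `e(z / N)` that is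
divisible by the `ℓ`-th cyclotomic polynomial in `e(z)`. -/
def CyclotomicDvd (ℓ : ℕ) (F : ℍ → ℂ) : Prop :=
  ∃ N : ℕ, 0 < N ∧ ∃ P : ℂ[T;T⁻¹], (∀ z : ℍ, F z = evalE P (z / N)) ∧
    Polynomial.aeval (LaurentPolynomial.T (N : ℤ) : ℂ[T;T⁻¹]) (Polynomial.cyclotomic ℓ ℂ) ∣ P

/-- The complex number `x` lies in the localization of the ring of integers of `K` at the prime
ideal `𝔩`. -/
def IsIntegralAt (K : IntermediateField ℚ ℂ) (𝔩 : Ideal (𝓞 K)) (x : ℂ) : Prop :=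
  ∃ y s : 𝓞 K, s ∉ 𝔩 ∧ x = ((y : K) : ℂ) / ((s : K) : ℂ)

/-- `φ`, which specializes to `f`, explains the Ramanujan-type congruence modulo `ℓ` of `f` on
`M ℤ + β`; integrality of Fourier coefficients refers to the prime `𝔩` of `K`. -/
def ExplainsCongruenceOf (Γ : Subgroup Mp1Z) (χ : Γ →* ℂˣ) (w : ℤ) (K : IntermediateField ℚ ℂ)
    (𝔩 : Ideal (𝓞 K)) (ℓ : ℕ) (M : ℕ+) (β : ℚ) (φ : ℍ → ℂ → ℂ) (f : ℍ → ℂ) : Prop :=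
  ∃ (ν : ℤ) (c : ℚ → ℚ → ℂ),
    IsWeaklyHolomorphicModularForm Γ χ (w - 2 * ν) f ∧ SpecializesTo φ ν f ∧
    IsFourierExpansion φ c ∧ (∀ n r : ℚ, IsIntegralAt K 𝔩 (c n r)) ∧
    ∀ n : ℚ, (∃ j : ℤ, n = (M : ℕ) * j + β) → CyclotomicDvd ℓ (leadingCoeff c ν n)

/-- `φ` explains a Ramanujan-type congruence modulo `ℓ` on `M ℤ + β`. -/
def ExplainsCongruence (Γ : Subgroup Mp1Z) (χ : Γ →* ℂˣ) (w : ℤ) (K : IntermediateField ℚ ℂ)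
    (𝔩 : Ideal (𝓞 K)) (ℓ : ℕ) (M : ℕ+) (β : ℚ) (φ : ℍ → ℂ → ℂ) : Prop :=
  ∃ f : ℍ → ℂ, ExplainsCongruenceOf Γ χ w K 𝔩 ℓ M β φ f

end JacobiRC

end

noncomputable section

namespace JacobiRC

/-! ### The normalized exponential -/

/-! Of the conditions defining an explained congruence, only divisibility by the cyclotomic
polynomial Φ_ℓ involves the progression, so only this condition has to be transferred.

It is first turned into a vanishing statement at torsion points. Put ψ = (e(z) - 1)^ν φ. Its
singularities at the integers are removable, and for n ≡ β modulo 1 the leading coefficient is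
e(z/2)^(-ν) times the n-th Fourier coefficient of ψ in τ; for all other n it is zero
(`leadingCoeff_eq`). This Fourier coefficient is a Laurent polynomial in e(z)
(`exists_tauCoeff_eq_sum`): the growth of φ along z = ±τ/2 + u forces the double Fourier
coefficients to vanish when n + r/2 or n - r/2 is very negative, so only finitely many r remain for
each n. Divisibility by Φ_ℓ thus amounts to vanishing of the Fourier coefficient at z = j/ℓ for all
j prime to ℓ.

At a fixed torsion point t, vanishing on Mℤ + β gives the identity ∑_{k mod M} e(-kβ/M) ψ(τ + k/M,
t) = 0 in τ (`sum_translate_eq_zero`), and such an identity with a²β in place of β gives vanishing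
back on Mℤ + a²β, at the indices congruent to β modulo 1 (`tauCoeff_eq_zero_of_sum_translate`).

The group enters in `exists_torsion_factor`. The conjugate by δ_M of T^(a²h) γ T^(-h) sends (τ +
h)/M to (γτ + a²h)/M. Its root and denominator at (τ + h)/M, and its character value by definition
of Γ_M^Δ(χ), do not depend on h. Since ℓ ∣ c, the torsion point is multiplied by d up to a lattice
vector, which the Heisenberg action absorbs. So the sum of translates for a²β is a multiple of the
sum for β with h replaced by a²h. As a is prime to M, this permutes the residues modulo M, and the
sum vanishes. -/

theorem e_zero : e 0 = 1 := by simp [e]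

theorem e_add (z w : ℂ) : e (z + w) = e z * e w := by
  simp [e, mul_add, Complex.exp_add]

theorem e_neg (z : ℂ) : e (-z) = (e z)⁻¹ := by
  simp [e, Complex.exp_neg]

theorem e_nat_mul (n : ℕ) (z : ℂ) : e (n * z) = e z ^ n := by
  rw [e, e, ← Complex.exp_nat_mul]
  ring_nf

theorem e_int_mul (n : ℤ) (z : ℂ) : e (n * z) = e z ^ n := by
  rw [e, e, ← Complex.exp_int_mul]
  ring_nf

theorem e_one : e 1 = 1 := by simp [e, Complex.exp_two_pi_mul_I]

theorem e_int (n : ℤ) : e n = 1 := by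
  have := e_int_mul n 1
  simpa [e_one] using this

theorem e_add_int (z : ℂ) (n : ℤ) : e (z + n) = e z := by rw [e_add, e_int, mul_one]

theorem e_add_one (z : ℂ) : e (z + 1) = e z := by rw [e_add, e_one, mul_one]

theorem e_eq_one_iff (z : ℂ) : e z = 1 ↔ ∃ n : ℤ, z = n := by
  rw [e, Complex.exp_eq_one_iff]
  refine exists_congr fun n ↦ ?_
  rw [mul_comm]
  exact mul_left_inj' Complex.two_pi_I_ne_zero

theorem norm_e (z : ℂ) : ‖e z‖ = Real.exp (-(2 * Real.pi * z.im)) := by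
  rw [e, Complex.norm_exp]
  simp

theorem norm_e_rat (x : ℚ) : ‖e x‖ = 1 := by simp [norm_e]

@[fun_prop]
theorem differentiable_e : Differentiable ℂ e := by
  unfold e
  fun_prop

@[fun_prop]
theorem continuous_e : Continuous e := differentiable_e.continuous

/-! ### Fourier coefficients of periodic functions -/

theorem integral_e_int (k : ℤ) : ∫ x in (0 : ℝ)..1, e (k * x) = if k = 0 then 1 else 0 := by
  split_ifs with h
  · simp [h, e_zero]
  · have hc : (2 * Real.pi * Complex.I * k : ℂ) ≠ 0 :=
      mul_ne_zero Complex.two_pi_I_ne_zero (by exact_mod_cast h)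
    have h1 : ∀ x : ℝ, e (k * x) = Complex.exp ((2 * Real.pi * Complex.I * k : ℂ) * x) :=
      fun x ↦ by rw [e]; ring_nf
    simp_rw [h1]
    rw [integral_exp_mul_complex hc]
    have h2 : Complex.exp ((2 * Real.pi * Complex.I * k : ℂ) * (1 : ℝ)) = 1 := by
      have := e_int k
      rw [e] at this
      simpa using this
    rw [h2]
    simp

/-- A continuous function of period `1` whose Fourier coefficients vanish outside a finite set is
the sum of its Fourier series. -/
theorem eq_sum_fourier {g : ℝ → ℂ} (hg : Continuous g) (hp : Function.Periodic g 1) (S : Finset ℤ)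
    (hS : ∀ k ∉ S, ∫ x in (0 : ℝ)..1, g x * e (-(k * x)) = 0) (x : ℝ) :
    g x = ∑ k ∈ S, (∫ t in (0 : ℝ)..1, g t * e (-(k * t))) * e (k * x) := by
  have hc : Continuous hp.lift := by
    apply continuous_coinduced_dom.mpr
    exact hg
  let f : C(UnitAddCircle, ℂ) := ⟨hp.lift, hc⟩
  have hfx : ∀ t : ℝ, f (t : UnitAddCircle) = g t := fun t ↦ rfl
  have hfour : ∀ (k : ℤ) (t : ℝ), fourier k (t : UnitAddCircle) = e (k * t) := fun k t ↦ by
    rw [fourier_coe_apply, e]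
    congr 1
    push_cast
    ring
  have hcoef : ∀ k : ℤ, fourierCoeff f k = ∫ t in (0 : ℝ)..1, g t * e (-(k * t)) := fun k ↦ by
    rw [fourierCoeff_eq_intervalIntegral f k 0]
    simp only [zero_add, div_one, one_smul]
    refine intervalIntegral.integral_congr fun t _ ↦ ?_
    simp only [hfour, hfx, smul_eq_mul]
    rw [mul_comm]
    push_cast
    rw [neg_mul]
  have hsum : Summable (fourierCoeff f) :=
    summable_of_ne_finset_zero (s := S) fun k hk ↦ by rw [hcoef, hS k hk]
  have h1 := has_pointwise_sum_fourier_series_of_summable hsum (x : UnitAddCircle)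
  rw [hfx] at h1
  rw [← h1.tsum_eq, tsum_eq_sum (s := S)]
  · exact Finset.sum_congr rfl fun k _ ↦ by rw [hcoef, hfour, smul_eq_mul]
  · intro k hk
    rw [hcoef, hS k hk, zero_smul]

/-! ### Contour shifts -/

/-- The integral over a period of a periodic function along a horizontal line does not depend on
the line, provided that the function is holomorphic between the two lines off a countable set. -/
theorem integral_eq_of_periodic {f : ℂ → ℂ} {a p v₁ v₂ : ℝ} {s : Set ℂ} (hs : s.Countable)
    (hc : ∀ z : ℂ, z.re ∈ Set.uIcc a (a + p) → z.im ∈ Set.uIcc v₁ v₂ → ContinuousAt f z)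
    (hd : ∀ z : ℂ, z.re ∈ Set.uIcc a (a + p) → z.im ∈ Set.uIcc v₁ v₂ → z ∉ s →
      DifferentiableAt ℂ f z)
    (hp : ∀ v ∈ Set.uIcc v₁ v₂, f ((a + p : ℝ) + v * Complex.I) = f (a + v * Complex.I)) :
    ∫ x in a..a + p, f (x + v₁ * Complex.I) = ∫ x in a..a + p, f (x + v₂ * Complex.I) := by
  have h := Complex.integral_boundary_rect_eq_zero_of_differentiable_on_off_countable f
    (a + v₁ * Complex.I) ((a + p : ℝ) + v₂ * Complex.I) s hs
    (fun z hz ↦ by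
      rw [Complex.mem_reProdIm] at hz
      exact (hc z (by simpa using hz.1) (by simpa using hz.2)).continuousWithinAt)
    (fun z hz ↦ by
      obtain ⟨hz, hzs⟩ := hz
      rw [Complex.mem_reProdIm] at hz
      refine hd z ?_ ?_ hzs
      · exact Set.Ioo_subset_Icc_self (by simpa using hz.1)
      · exact Set.Ioo_subset_Icc_self (by simpa using hz.2))
  have h2 : ∫ y : ℝ in v₁..v₂, f ((a + p : ℝ) + y * Complex.I) =
      ∫ y : ℝ in v₁..v₂, f (a + y * Complex.I) :=
    intervalIntegral.integral_congr fun v hv ↦ hp v hv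
  simp only [Complex.add_re, Complex.ofReal_re, Complex.mul_re, Complex.I_re, mul_zero,
    Complex.ofReal_im, Complex.I_im, mul_one, sub_self, add_zero, Complex.add_im, Complex.mul_im,
    zero_add] at h
  rw [h2] at h
  linear_combination h

/-! ### Almost periodic sums -/

theorem norm_geom_mean_le {q : ℂ} (hq : ‖q‖ = 1) (L : ℕ) :
    ‖(L : ℂ)⁻¹ * ∑ h ∈ Finset.range L, q ^ h‖ ≤ 1 := by
  rcases Nat.eq_zero_or_pos L with rfl | hL
  · simp
  rw [norm_mul, norm_inv, Complex.norm_natCast]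
  have h1 : ‖∑ h ∈ Finset.range L, q ^ h‖ ≤ L := by
    refine (norm_sum_le _ _).trans ?_
    simp [hq]
  have hL' : (0 : ℝ) < L := by exact_mod_cast hL
  rw [inv_mul_le_iff₀ hL']
  simpa using h1

/-- For q ≠ 1 the geometric sums stay bounded by 2/‖q - 1‖, so division by L sends them to zero. -/
theorem tendsto_geom_mean {q : ℂ} (hq : ‖q‖ = 1) :
    Tendsto (fun L : ℕ ↦ (L : ℂ)⁻¹ * ∑ h ∈ Finset.range L, q ^ h) atTop
      (𝓝 (if q = 1 then 1 else 0)) := by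
  split_ifs with h
  · refine tendsto_const_nhds.congr' ?_
    filter_upwards [eventually_gt_atTop 0] with L hL
    have : (L : ℂ) ≠ 0 := by exact_mod_cast hL.ne'
    simp [h, this]
  · have hq1 : q - 1 ≠ 0 := sub_ne_zero.mpr h
    rw [tendsto_zero_iff_norm_tendsto_zero]
    have h0 : Tendsto (fun L : ℕ ↦ (2 / ‖q - 1‖) * ((L : ℝ))⁻¹) atTop (𝓝 0) := by
      simpa using (tendsto_inv_atTop_nhds_zero_nat (𝕜 := ℝ)).const_mul (2 / ‖q - 1‖)
    refine squeeze_zero (fun _ ↦ norm_nonneg _) (fun L ↦ ?_) h0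
    rw [geom_sum_eq h, norm_mul, norm_inv, Complex.norm_natCast, norm_div, mul_comm]
    gcongr
    refine (norm_sub_le _ _).trans ?_
    rw [norm_pow, hq]
    norm_num

/-- Fourier coefficients of an absolutely convergent sum `∑ b(n) e(n x)` over rational `n` that is
periodic up to the factor `e(β)`. -/
theorem coeff_of_quasiperiodic {b : ℚ → ℂ} (hb : Summable fun n ↦ ‖b n‖) {G : ℝ → ℂ}
    (hG : ∀ x : ℝ, HasSum (fun n : ℚ ↦ b n * e (n * x)) (G x)) {β : ℚ}
    (hper : ∀ x : ℝ, G (x + 1) = e β * G x) (n₀ : ℚ) :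
    b n₀ = if e (β - n₀) = 1 then ∫ x in (0 : ℝ)..1, G x * e (-(n₀ * x)) else 0 := by
  set J : ℚ → ℂ := fun t ↦ ∫ x in (0 : ℝ)..1, e (t * x) with hJ
  have hJle : ∀ t, ‖J t‖ ≤ 1 := fun t ↦ by
    have := intervalIntegral.norm_integral_le_of_norm_le_const (a := 0) (b := 1) (C := 1)
      (f := fun x : ℝ ↦ e (t * x)) (fun x _ ↦ by simp [norm_e])
    simpa using this
  set I₀ := ∫ x in (0 : ℝ)..1, G x * e (-(n₀ * x)) with hI₀
  -- Translation by h multiplies the n-th term by e(n)^h and the whole sum by e(β)^h. Averaging over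
  -- h will therefore isolate classes modulo 1, with no assumption on denominators of the exponents.
  have hshift : ∀ h : ℕ, HasSum (fun n ↦ b n * J (n - n₀) * e (n - n₀) ^ h)
      (I₀ * e (β - n₀) ^ h) := by
    intro h
    have h1 : ∀ x : ℝ, G (x + h) = e β ^ h * G x := by
      intro x
      induction h with
      | zero => simp
      | succ h ih => rw [Nat.cast_succ, ← add_assoc, hper, ih]; ring
    have hG' : ∀ x : ℝ, HasSum (fun n : ℚ ↦ (b n * e (n - n₀) ^ h) * e (n * x))
        (e (-n₀) ^ h * (e β ^ h * G x)) := by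
      intro x
      rw [← h1]
      have h2 := (hG (x + h)).mul_left (e (-n₀) ^ h)
      convert! h2 using 1
      funext n
      rw [sub_eq_add_neg, e_add, mul_pow, ← e_nat_mul h n]
      have : (n : ℂ) * ((x + h : ℝ) : ℂ) = n * x + h * n := by push_cast; ring
      rw [this, e_add]
      ring
    have h3 := intervalIntegral.hasSum_intervalIntegral_of_summable_norm (a := 0) (b := 1)
      (f := fun n : ℚ ↦ (⟨fun x : ℝ ↦ b n * e (n - n₀) ^ h * e ((n - n₀ : ℚ) * x),
        by fun_prop⟩ : C(ℝ, ℂ))) (by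
        refine Summable.of_nonneg_of_le (fun _ ↦ norm_nonneg _) (fun n ↦ ?_) hb
        rw [ContinuousMap.norm_le _ (norm_nonneg _)]
        intro x
        simp [norm_e])
    convert! h3 using 1
    · funext n
      simp only [hJ, ContinuousMap.coe_mk]
      rw [intervalIntegral.integral_const_mul]
      ring
    · rw [hI₀, mul_comm, ← intervalIntegral.integral_const_mul]
      refine intervalIntegral.integral_congr fun x _ ↦ ?_
      have h2 := (hG' x).mul_right (e (-(n₀ * x)))
      simp only [ContinuousMap.coe_mk]
      have h4 : ∑' n : ℚ, b n * e (n - n₀) ^ h * e ((n - n₀ : ℚ) * x) =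
          e (-n₀) ^ h * (e β ^ h * G x) * e (-(n₀ * x)) := by
        rw [← h2.tsum_eq]
        refine tsum_congr fun n ↦ ?_
        rw [mul_assoc _ (e (n * x)), ← e_add]
        congr 2
        push_cast
        ring
      rw [h4, sub_eq_add_neg, e_add, mul_pow]
      ring
  have hmean : ∀ L : ℕ, ∑' n, b n * J (n - n₀) *
      ((L : ℂ)⁻¹ * ∑ h ∈ Finset.range L, e (n - n₀) ^ h) =
      I₀ * ((L : ℂ)⁻¹ * ∑ h ∈ Finset.range L, e (β - n₀) ^ h) := by
    intro L
    have h1 := (hasSum_sum fun h (_ : h ∈ Finset.range L) ↦ hshift h).mul_left ((L : ℂ)⁻¹)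
    have h2 : I₀ * ((L : ℂ)⁻¹ * ∑ h ∈ Finset.range L, e (β - n₀) ^ h) =
        (L : ℂ)⁻¹ * ∑ h ∈ Finset.range L, I₀ * e (β - n₀) ^ h := by
      rw [← Finset.mul_sum]; ring
    rw [h2, ← h1.tsum_eq]
    refine tsum_congr fun n ↦ ?_
    rw [← Finset.mul_sum]
    ring
  have hn1 : ∀ x y : ℚ, ‖e ((x : ℂ) - y)‖ = 1 := fun x y ↦ by
    rw [← Rat.cast_sub]; exact norm_e_rat _
  have hlim1 : Tendsto (fun L : ℕ ↦ ∑' n, b n * J (n - n₀) *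
      ((L : ℂ)⁻¹ * ∑ h ∈ Finset.range L, e (n - n₀) ^ h)) atTop
      (𝓝 (∑' n : ℚ, b n * J (n - n₀) * (if e ((n : ℂ) - n₀) = 1 then 1 else 0))) := by
    refine tendsto_tsum_of_dominated_convergence hb
      (fun n ↦ (tendsto_geom_mean (hn1 _ _)).const_mul _) (Eventually.of_forall fun L n ↦ ?_)
    rw [norm_mul, norm_mul]
    calc _ ≤ ‖b n‖ * 1 * 1 := by
          gcongr
          · exact hJle _
          · exact norm_geom_mean_le (hn1 _ _) L
      _ = _ := by ring
  have hlim2 : Tendsto (fun L : ℕ ↦ I₀ * ((L : ℂ)⁻¹ * ∑ h ∈ Finset.range L, e (β - n₀) ^ h)) atTop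
      (𝓝 (I₀ * (if e ((β : ℂ) - n₀) = 1 then 1 else 0))) :=
    (tendsto_geom_mean (hn1 _ _)).const_mul _
  simp_rw [hmean] at hlim1
  have heq := tendsto_nhds_unique hlim1 hlim2
  -- The averages leave only n in n₀ + ℤ; of these, integration over a unit interval kills every n ≠
  -- n₀.
  rw [tsum_eq_single n₀] at heq
  · simp only [sub_self, hJ, Rat.cast_zero, zero_mul, e_zero, if_true, mul_one,
      intervalIntegral.integral_const, sub_zero, one_smul] at heq
    rw [heq]
    simp
  · intro n hn
    split_ifs with h
    · obtain ⟨k, hk⟩ := (e_eq_one_iff _).1 h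
      have hk' : n - n₀ = k := by exact_mod_cast hk
      have hk0 : k ≠ 0 := by
        rintro rfl
        exact hn (by simpa [sub_eq_zero] using hk')
      have : J (n - n₀) = 0 := by
        rw [hk', hJ]
        simp only [Rat.cast_intCast]
        rw [integral_e_int, if_neg hk0]
      simp [this]
    · simp

/-! ### Fourier coefficients of functions in two variables -/

/-- The function `ψ` is holomorphic on the strip `|Im z| < Im τ` except for removable singularities
at integers `z`, periodic in both variables up to a constant factor, and its
restrictions to `z = ± τ / 2 + u` grow at most exponentially. -/
structure IsStripForm (ψ : ℂ → ℂ → ℂ) (β : ℚ) : Prop where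
  holo : ∀ τ z : ℂ, |z.im| < τ.im → (∀ u : ℤ, z ≠ u) →
    DifferentiableAt ℂ (fun q : ℂ × ℂ ↦ ψ q.1 q.2) (τ, z)
  per_z : ∀ τ z : ℂ, |z.im| < τ.im → (∀ u : ℤ, z ≠ u) → ψ τ (z + 1) = ψ τ z
  per_tau : ∀ τ z : ℂ, |z.im| < τ.im → (∀ u : ℤ, z ≠ u) → ψ (τ + 1) z = e β * ψ τ z
  removable : ∀ τ : ℂ, 0 < τ.im → ∃ L : ℂ, Tendsto (ψ τ) (𝓝[≠] 0) (𝓝 L)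
  growth : ∀ s : ℤ, (s = 1 ∨ s = -1) → ∃ a : ℝ, ∀ u : ℚ, ∃ C Y : ℝ, ∀ τ : ℂ, 0 < τ.im → Y ≤ τ.im →
    ‖ψ τ (s / 2 * τ + u)‖ ≤ C * Real.exp (a * τ.im)

/-- The Fourier coefficient of `ψ` with respect to `τ` along a horizontal line. -/
def tauCoeff (ψ : ℂ → ℂ → ℂ) (n : ℚ) (y : ℝ) (z : ℂ) : ℂ :=
  ∫ x in (0 : ℝ)..1, ψ (x + y * Complex.I) z * e (-(n * (x + y * Complex.I)))

/-- The Fourier coefficient of `ψ` with respect to `z` along a horizontal line. -/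
def zCoeff (ψ : ℂ → ℂ → ℂ) (r : ℤ) (v : ℝ) (τ : ℂ) : ℂ :=
  ∫ u in (-1 / 2 : ℝ)..(-1 / 2 + 1), ψ τ (u + v * Complex.I) * e (-(r * (u + v * Complex.I)))

/-- The Fourier coefficient of `ψ` with respect to both variables. -/
def biCoeff (ψ : ℂ → ℂ → ℂ) (n : ℚ) (r : ℤ) (y v : ℝ) : ℂ :=
  ∫ x in (0 : ℝ)..1, zCoeff ψ r v (x + y * Complex.I) * e (-(n * (x + y * Complex.I)))

theorem ne_int_of_im_ne_zero {z : ℂ} (hz : z.im ≠ 0) (u : ℤ) : z ≠ u := by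
  rintro rfl
  simp at hz

theorem re_add_mul_I (x y : ℝ) : ((x : ℂ) + y * Complex.I).re = x := by simp

theorem im_add_mul_I (x y : ℝ) : ((x : ℂ) + y * Complex.I).im = y := by simp

theorem integral_integral_swap_of_continuous {f : ℝ → ℝ → ℂ} (hf : Continuous (Function.uncurry f))
    (a b c d : ℝ) : ∫ x in a..b, ∫ y in c..d, f x y = ∫ y in c..d, ∫ x in a..b, f x y :=
  MeasureTheory.intervalIntegral_intervalIntegral_swap
    ((hf.continuousOn.integrableOn_compact (isCompact_uIcc.prod isCompact_uIcc)).mono_set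
      (Set.prod_mono Set.uIoc_subset_uIcc Set.uIoc_subset_uIcc))

/-! ### Independence of Fourier coefficients from the line of integration -/

namespace IsStripForm

variable {ψ : ℂ → ℂ → ℂ} {β : ℚ}

theorem continuousAt (h : IsStripForm ψ β) {τ z : ℂ} (hz : |z.im| < τ.im)
    (hu : ∀ u : ℤ, z ≠ u) : ContinuousAt (fun q : ℂ × ℂ ↦ ψ q.1 q.2) (τ, z) :=
  (h.holo τ z hz hu).continuousAt

theorem continuous_comp (h : IsStripForm ψ β) {X : Type*} [TopologicalSpace X] {f g : X → ℂ}
    (hf : Continuous f) (hg : Continuous g) (hz : ∀ x, |(g x).im| < (f x).im)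
    (hu : ∀ (x) (u : ℤ), g x ≠ u) : Continuous fun x ↦ ψ (f x) (g x) := by
  rw [continuous_iff_continuousAt]
  intro x
  exact (h.continuousAt (hz x) (hu x)).comp (f := fun x ↦ (f x, g x))
    (hf.prodMk hg).continuousAt

theorem differentiableAt_left (h : IsStripForm ψ β) {τ z : ℂ} (hz : |z.im| < τ.im)
    (hu : ∀ u : ℤ, z ≠ u) : DifferentiableAt ℂ (fun t ↦ ψ t z) τ :=
  DifferentiableAt.comp (g := fun q : ℂ × ℂ ↦ ψ q.1 q.2) (f := fun t ↦ (t, z)) τ (h.holo τ z hz hu)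
    (by fun_prop)

theorem differentiableAt_right (h : IsStripForm ψ β) {τ z : ℂ} (hz : |z.im| < τ.im)
    (hu : ∀ u : ℤ, z ≠ u) : DifferentiableAt ℂ (ψ τ) z :=
  DifferentiableAt.comp (g := fun q : ℂ × ℂ ↦ ψ q.1 q.2) (f := fun t ↦ (τ, t)) z (h.holo τ z hz hu)
    (by fun_prop)

/-- The congruence n ≡ β modulo 1 makes the integrand periodic in τ, and ψ(·, z) has no singularity
above height |Im z|, so the contour can be moved. -/
theorem tauCoeff_eq (h : IsStripForm ψ β) {n : ℚ} (hn : e (β - n) = 1) {z : ℂ}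
    (hu : ∀ u : ℤ, z ≠ u) {y₁ y₂ : ℝ} (hy₁ : |z.im| < y₁) (hy₂ : |z.im| < y₂) :
    tauCoeff ψ n y₁ z = tauCoeff ψ n y₂ z := by
  have hy : ∀ y ∈ Set.uIcc y₁ y₂, |z.im| < y := fun y hy ↦ by
    rcases Set.mem_uIcc.1 hy with hy | hy <;> linarith [hy.1]
  have hd : ∀ τ : ℂ, τ.im ∈ Set.uIcc y₁ y₂ →
      DifferentiableAt ℂ (fun τ ↦ ψ τ z * e (-(n * τ))) τ := fun τ hτ ↦
    (h.differentiableAt_left (hy _ hτ) hu).mul (by fun_prop)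
  have := integral_eq_of_periodic (f := fun τ ↦ ψ τ z * e (-(n * τ))) (a := 0) (p := 1)
    (v₁ := y₁) (v₂ := y₂) Set.countable_empty (fun τ _ hτ ↦ (hd τ hτ).continuousAt)
    (fun τ _ hτ _ ↦ hd τ hτ) (fun y hyy ↦ by
      have h1 : (((0 + 1 : ℝ) : ℂ) + y * Complex.I) = y * Complex.I + 1 := by push_cast; ring
      have h2 : (((0 : ℝ) : ℂ) + y * Complex.I) = y * Complex.I := by simp
      rw [h1, h2, h.per_tau _ _ (by simpa using hy y hyy) hu]
      have h3 : e (-(n * (y * Complex.I + 1))) = e (-(n * (y * Complex.I))) * e (-n) := by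
        rw [← e_add]; ring_nf
      rw [h3]
      rw [sub_eq_add_neg, e_add] at hn
      linear_combination ψ (y * Complex.I) z * e (-(n * (y * Complex.I))) * hn)
  simpa [tauCoeff] using this

/-- Here v₁ and v₂ may have opposite signs: the period from -1/2 to 1/2 meets the integers only at
0, where the singularity is removable, and its endpoints avoid them. This crossing of the real line
is what links the lines z = τ/2 + u and z = -τ/2 + u. -/
theorem zCoeff_eq (h : IsStripForm ψ β) (r : ℤ) {τ : ℂ} {v₁ v₂ : ℝ} (hv₁ : v₁ ≠ 0) (hv₂ : v₂ ≠ 0)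
    (hy₁ : |v₁| < τ.im) (hy₂ : |v₂| < τ.im) : zCoeff ψ r v₁ τ = zCoeff ψ r v₂ τ := by
  obtain ⟨L, hL⟩ := h.removable τ ((abs_nonneg _).trans_lt hy₁)
  set g : ℂ → ℂ := Function.update (ψ τ) 0 L with hg
  have hgne : ∀ z, z ≠ 0 → g z = ψ τ z := fun z hz ↦ Function.update_of_ne hz _ _
  have hgc0 : ContinuousAt g 0 := by
    rw [hg, continuousAt_update_same]
    exact hL
  have hy : ∀ v ∈ Set.uIcc v₁ v₂, |v| < τ.im := fun v hv ↦ by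
    rw [abs_lt] at *
    rcases Set.mem_uIcc.1 hv with hv | hv <;> constructor <;> linarith [hv.1, hv.2]
  have hint : ∀ z : ℂ, z.re ∈ Set.uIcc (-1 / 2 : ℝ) (-1 / 2 + 1) → z ≠ 0 → ∀ u : ℤ, z ≠ u := by
    rintro z hz hz0 u rfl
    rw [Set.uIcc_of_le (by norm_num)] at hz
    simp only [Complex.intCast_re, Set.mem_Icc] at hz
    have h1 : -1 < (u : ℝ) := by linarith [hz.1]
    have h2 : (u : ℝ) < 1 := by linarith [hz.2]
    have : u = 0 := by
      have h1' : -1 < u := by exact_mod_cast h1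
      have h2' : u < 1 := by exact_mod_cast h2
      omega
    exact hz0 (by simp [this])
  have hgd : ∀ z : ℂ, z.re ∈ Set.uIcc (-1 / 2 : ℝ) (-1 / 2 + 1) → z.im ∈ Set.uIcc v₁ v₂ → z ≠ 0 →
      DifferentiableAt ℂ g z := fun z hz hz' hz0 ↦ by
    refine (h.differentiableAt_right (hy _ hz') (hint z hz hz0)).congr_of_eventuallyEq ?_
    filter_upwards [isOpen_ne.mem_nhds hz0] with w hw using hgne w hw
  have hne : ∀ (v : ℝ), v ≠ 0 → ∀ u : ℝ, ((u : ℂ) + v * Complex.I) ≠ 0 := fun v hv u h0 ↦ by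
    have := congrArg Complex.im h0
    simp [hv] at this
  have hne' : ∀ (u : ℝ), u ≠ 0 → ∀ v : ℝ, ((u : ℂ) + v * Complex.I) ≠ 0 := fun u hu v h0 ↦ by
    have := congrArg Complex.re h0
    simp [hu] at this
  have := integral_eq_of_periodic (f := fun z ↦ g z * e (-(r * z))) (a := -1 / 2) (p := 1)
    (v₁ := v₁) (v₂ := v₂) (s := {0}) (Set.countable_singleton 0)
    (fun z hz hz' ↦ by
      refine ContinuousAt.mul ?_ (by fun_prop)
      by_cases hz0 : z = 0
      · rw [hz0]; exact hgc0
      · exact (hgd z hz hz' hz0).continuousAt)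
    (fun z hz hz' hz0 ↦ (hgd z hz hz' hz0).mul (by fun_prop))
    (fun v hv ↦ by
      rw [hgne _ (hne' _ (by norm_num) v), hgne _ (hne' _ (by norm_num) v)]
      have h1 : (((-1 / 2 + 1 : ℝ) : ℂ) + v * Complex.I) =
        ((-1 / 2 : ℝ) : ℂ) + v * Complex.I + 1 := by push_cast; ring
      rw [h1, h.per_z]
      · congr 1
        rw [mul_add, neg_add, e_add, mul_one]
        have := e_int (-r)
        push_cast at this
        rw [this, mul_one]
      · rw [im_add_mul_I]; exact hy v hv
      · refine hint _ ?_ (hne' _ (by norm_num) v)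
        rw [re_add_mul_I]
        exact Set.left_mem_uIcc)
  unfold zCoeff
  simp_rw [hgne _ (hne v₁ hv₁ _), hgne _ (hne v₂ hv₂ _)] at this
  exact this

theorem continuous_line (h : IsStripForm ψ β) {y v : ℝ} (hv : v ≠ 0) (hy : |v| < y) :
    Continuous fun p : ℝ × ℝ ↦ ψ (p.1 + y * Complex.I) (p.2 + v * Complex.I) :=
  h.continuous_comp (by fun_prop) (by fun_prop) (by simpa using hy)
    (fun p ↦ ne_int_of_im_ne_zero (by simpa using hv))

theorem continuous_zCoeff (h : IsStripForm ψ β) (r : ℤ) {y v : ℝ} (hv : v ≠ 0) (hy : |v| < y) :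
    Continuous fun x : ℝ ↦ zCoeff ψ r v (x + y * Complex.I) := by
  unfold zCoeff
  refine intervalIntegral.continuous_parametric_intervalIntegral_of_continuous'
    (f := fun (x u : ℝ) ↦ ψ (x + y * Complex.I) (u + v * Complex.I) *
      e (-(r * (u + v * Complex.I)))) ?_ _ _
  exact (h.continuous_line hv hy).mul (by fun_prop)

theorem continuous_tauCoeff (h : IsStripForm ψ β) (n : ℚ) {y v : ℝ} (hv : v ≠ 0) (hy : |v| < y) :
    Continuous fun u : ℝ ↦ tauCoeff ψ n y (u + v * Complex.I) := by
  unfold tauCoeff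
  refine intervalIntegral.continuous_parametric_intervalIntegral_of_continuous'
    (f := fun (u x : ℝ) ↦ ψ (x + y * Complex.I) (u + v * Complex.I) *
      e (-(n * (x + y * Complex.I)))) ?_ _ _
  exact ((h.continuous_line hv hy).comp continuous_swap).mul (by fun_prop)

theorem biCoeff_eq_integral_tauCoeff (h : IsStripForm ψ β) (n : ℚ) (r : ℤ) {y v : ℝ}
    (hv : v ≠ 0) (hy : |v| < y) :
    biCoeff ψ n r y v = ∫ u in (-1 / 2 : ℝ)..(-1 / 2 + 1),
      tauCoeff ψ n y (u + v * Complex.I) * e (-(r * (u + v * Complex.I))) := by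
  unfold biCoeff zCoeff tauCoeff
  simp_rw [← intervalIntegral.integral_mul_const]
  rw [integral_integral_swap_of_continuous]
  · refine intervalIntegral.integral_congr fun u _ ↦ ?_
    refine intervalIntegral.integral_congr fun x _ ↦ ?_
    ring
  · exact ((h.continuous_line hv hy).mul (by fun_prop)).mul (by fun_prop)

/-- Raising y to the maximum of both heights makes v₁ and v₂ admissible at once; there v is moved,
and then y is lowered. -/
theorem biCoeff_eq (h : IsStripForm ψ β) {n : ℚ} (hn : e (β - n) = 1) (r : ℤ) {y₁ v₁ y₂ v₂ : ℝ}
    (hv₁ : v₁ ≠ 0) (hy₁ : |v₁| < y₁) (hv₂ : v₂ ≠ 0) (hy₂ : |v₂| < y₂) :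
    biCoeff ψ n r y₁ v₁ = biCoeff ψ n r y₂ v₂ := by
  have hz : ∀ {y v v' : ℝ}, v ≠ 0 → |v| < y → v' ≠ 0 → |v'| < y →
      biCoeff ψ n r y v = biCoeff ψ n r y v' := fun hv hy hv' hy' ↦
    intervalIntegral.integral_congr fun x _ ↦ by
      rw [h.zCoeff_eq r hv hv' (by rwa [im_add_mul_I]) (by rwa [im_add_mul_I])]
  have ht : ∀ {y y' v : ℝ}, v ≠ 0 → |v| < y → |v| < y' →
      biCoeff ψ n r y v = biCoeff ψ n r y' v := fun hv hy hy' ↦ by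
    rw [h.biCoeff_eq_integral_tauCoeff n r hv hy, h.biCoeff_eq_integral_tauCoeff n r hv hy']
    refine intervalIntegral.integral_congr fun u _ ↦ ?_
    rw [h.tauCoeff_eq hn (ne_int_of_im_ne_zero (by rwa [im_add_mul_I])) (by rwa [im_add_mul_I])
      (by rwa [im_add_mul_I])]
  have h1 : |v₁| < max y₁ y₂ := hy₁.trans_le (le_max_left _ _)
  have h2 : |v₂| < max y₁ y₂ := hy₂.trans_le (le_max_right _ _)
  rw [ht hv₁ hy₁ h1, hz hv₁ h1 hv₂ h2, ht hv₂ h2 hy₂]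

end IsStripForm

/-! ### Vanishing of double Fourier coefficients and Laurent polynomiality -/

namespace IsStripForm

variable {ψ : ℂ → ℂ → ℂ} {β : ℚ}

theorem half_mul_im (s : ℤ) (τ : ℂ) (u : ℝ) : ((s : ℂ) / 2 * τ + u).im = s / 2 * τ.im := by
  have : (s : ℂ) / 2 = ((s / 2 : ℝ) : ℂ) := by push_cast; rfl
  rw [this]
  simp

theorem half_mul_im_ne_zero {s : ℤ} (hs : s = 1 ∨ s = -1) {y : ℝ} (hy : 0 < y) :
    (s / 2 * y : ℝ) ≠ 0 := by
  rcases hs with rfl | rfl <;> simp [hy.ne']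

theorem abs_half_mul_im_lt {s : ℤ} (hs : s = 1 ∨ s = -1) {y : ℝ} (hy : 0 < y) :
    |(s / 2 * y : ℝ)| < y := by
  rcases hs with rfl | rfl <;> rw [abs_lt] <;> push_cast <;> constructor <;> linarith

/-- Restricted to `z = ± τ / 2 + u`, the form `ψ` has vanishing Fourier coefficients of sufficiently
negative index. -/
theorem integral_half_line_eq_zero (h : IsStripForm ψ β) {s : ℤ} (hs : s = 1 ∨ s = -1) :
    ∃ A : ℝ, ∀ (n : ℚ) (r : ℤ), e (β - n) = 1 → (n + s / 2 * r : ℝ) < A → ∀ (y : ℝ), 0 < y →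
      ∀ u : ℝ, ∫ x in (0 : ℝ)..2, ψ (x + y * Complex.I) (s / 2 * (x + y * Complex.I) + u) *
        e (-((n + s / 2 * r) * (x + y * Complex.I))) = 0 := by
  obtain ⟨a, ha⟩ := h.growth s hs
  -- Below this threshold the growth exp(a Im τ) is beaten by the exponential factor: their product
  -- decays as Im τ → ∞.
  refine ⟨-a / (2 * Real.pi), fun n r hn hA y hy ↦ ?_⟩
  set N : ℂ := n + s / 2 * r with hN
  have hNr : N = ((n + s / 2 * r : ℝ) : ℂ) := by rw [hN]; push_cast; rfl
  have hlt : ∀ τ : ℂ, 0 < τ.im → ∀ u : ℝ, |((s : ℂ) / 2 * τ + u).im| < τ.im := fun τ hτ u ↦ by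
    rw [half_mul_im]; exact abs_half_mul_im_lt hs hτ
  have hni : ∀ τ : ℂ, 0 < τ.im → ∀ (u : ℝ) (k : ℤ), (s : ℂ) / 2 * τ + u ≠ k := fun τ hτ u ↦
    ne_int_of_im_ne_zero (by rw [half_mul_im]; exact half_mul_im_ne_zero hs hτ)
  set g : ℝ → ℂ → ℂ := fun u τ ↦ ψ τ (s / 2 * τ + u) * e (-(N * τ)) with hg
  have hdiff : ∀ (u : ℝ) (τ : ℂ), 0 < τ.im → DifferentiableAt ℂ (g u) τ := fun u τ hτ ↦ by
    refine DifferentiableAt.mul ?_ (by fun_prop)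
    exact DifferentiableAt.comp (g := fun q : ℂ × ℂ ↦ ψ q.1 q.2)
      (f := fun t ↦ (t, (s : ℂ) / 2 * t + u)) τ (h.holo τ _ (hlt τ hτ u) (hni τ hτ u)) (by fun_prop)
  -- The period is 2 because τ ↦ τ + 2 moves z = ±τ/2 + u by the integer ±1.
  have hper : ∀ (u : ℝ) (τ : ℂ), 0 < τ.im → g u (τ + 2) = g u τ := fun u τ hτ ↦ by
    have h1 : ψ (τ + 2) (s / 2 * τ + u) = e β * e β * ψ τ (s / 2 * τ + u) := by
      have e2 : τ + 2 = τ + 1 + 1 := by ring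
      rw [e2, h.per_tau _ _ (by simpa using hlt τ hτ u) (hni τ hτ u),
        h.per_tau _ _ (hlt τ hτ u) (hni τ hτ u), mul_assoc]
    have h2 : ψ (τ + 2) (s / 2 * (τ + 2) + u) = ψ (τ + 2) (s / 2 * τ + u) := by
      have hτ2 : (τ + 2).im = τ.im := by simp
      have hl1 := hlt τ hτ u
      rw [← hτ2] at hl1
      rcases hs with hs' | hs'
      · have e1 : (s : ℂ) / 2 * (τ + 2) + u = s / 2 * τ + u + 1 := by rw [hs']; push_cast; ring
        rw [e1, h.per_z _ _ hl1 (hni τ hτ u)]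
      · have e1 : (s : ℂ) / 2 * τ + u = s / 2 * (τ + 2) + u + 1 := by rw [hs']; push_cast; ring
        have hp : 0 < (τ + 2).im := by rwa [hτ2]
        rw [e1, h.per_z _ _ (hlt _ hp u) (hni _ hp u)]
    have h3 : e (-(N * (τ + 2))) = e (-(N * τ)) * (e (-n) * e (-n)) := by
      have e1 : -(N * (τ + 2)) = -(N * τ) + (-n + -n) + ((-(s * r) : ℤ) : ℂ) := by
        rw [hN]; push_cast; ring
      rw [e1, e_add_int, e_add, e_add (-(n : ℂ))]
    rw [sub_eq_add_neg, e_add] at hn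
    simp only [hg]
    rw [h2, h1, h3]
    linear_combination (ψ τ (s / 2 * τ + u) * e (-(N * τ)) * (e β * e (-n) + 1)) * hn
  have hindep : ∀ (u : ℝ) (y' : ℝ), 0 < y' → ∫ x in (0 : ℝ)..2, g u (x + y * Complex.I) =
      ∫ x in (0 : ℝ)..2, g u (x + y' * Complex.I) := fun u y' hy' ↦ by
    have hpos : ∀ v ∈ Set.uIcc y y', 0 < v := fun v hv ↦ by
      rcases Set.mem_uIcc.1 hv with hv | hv <;> linarith [hv.1]
    have := integral_eq_of_periodic (f := g u) (a := 0) (p := 2) (v₁ := y) (v₂ := y')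
      Set.countable_empty (fun τ _ hτ ↦ (hdiff u τ (hpos _ hτ)).continuousAt)
      (fun τ _ hτ _ ↦ hdiff u τ (hpos _ hτ)) (fun v hv ↦ by
        have e1 : (((0 + 2 : ℝ) : ℂ) + v * Complex.I) =
          (((0 : ℝ) : ℂ) + v * Complex.I) + 2 := by push_cast; ring
        rw [e1, hper]
        rw [im_add_mul_I]
        exact hpos v hv)
    simpa using this
  have hrat : ∀ u : ℚ, ∫ x in (0 : ℝ)..2, g u (x + y * Complex.I) = 0 := fun u ↦ by
    obtain ⟨C, Y, hC⟩ := ha u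
    set b : ℝ := a + 2 * Real.pi * (n + s / 2 * r) with hb
    have hbneg : b < 0 := by
      rw [lt_div_iff₀ (by positivity)] at hA
      rw [hb]; linarith
    have hbound : ∀ᶠ y' : ℝ in atTop, ‖∫ x in (0 : ℝ)..2, g u (x + y * Complex.I)‖ ≤
        C * Real.exp (b * y') * |2 - 0| := by
      filter_upwards [eventually_gt_atTop 0, eventually_ge_atTop Y] with y' hy' hY
      rw [hindep u y' hy']
      refine intervalIntegral.norm_integral_le_of_norm_le_const fun x _ ↦ ?_
      have h1 := hC (x + y' * Complex.I) (by rwa [im_add_mul_I]) (by rwa [im_add_mul_I])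
      rw [im_add_mul_I] at h1
      have h2 : ‖e (-(N * (x + y' * Complex.I)))‖ =
          Real.exp (2 * Real.pi * (n + s / 2 * r) * y') := by
        rw [norm_e, Complex.neg_im, hNr, Complex.im_ofReal_mul, im_add_mul_I]
        ring_nf
      simp only [hg, norm_mul]
      rw [h2, hb, add_mul a, Real.exp_add, ← mul_assoc]
      have : ((u : ℝ) : ℂ) = (u : ℂ) := by norm_cast
      rw [this]
      gcongr
    have hlim : Tendsto (fun y' : ℝ ↦ C * Real.exp (b * y') * |2 - 0|) atTop (𝓝 0) := by
      have h1 : Tendsto (fun y' : ℝ ↦ Real.exp (b * y')) atTop (𝓝 0) :=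
        Real.tendsto_exp_atBot.comp (tendsto_id.const_mul_atTop_of_neg hbneg)
      simpa using (h1.const_mul C).mul_const |(2 : ℝ) - 0|
    have := ge_of_tendsto hlim hbound
    exact norm_le_zero_iff.1 this
  have hcont : Continuous fun u : ℝ ↦ ∫ x in (0 : ℝ)..2, g u (x + y * Complex.I) := by
    refine intervalIntegral.continuous_parametric_intervalIntegral_of_continuous'
      (f := fun (u x : ℝ) ↦ g u (x + y * Complex.I)) ?_ _ _
    refine Continuous.mul ?_ (by fun_prop)
    have hp : ∀ p : ℝ × ℝ, 0 < ((p.2 : ℂ) + y * Complex.I).im := fun p ↦ by rwa [im_add_mul_I]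
    exact h.continuous_comp (f := fun p : ℝ × ℝ ↦ (p.2 : ℂ) + y * Complex.I)
      (g := fun p : ℝ × ℝ ↦ (s : ℂ) / 2 * ((p.2 : ℂ) + y * Complex.I) + p.1) (by fun_prop)
      (by fun_prop) (fun p ↦ hlt _ (hp p) _) (fun p ↦ hni _ (hp p) _)
  -- The growth bound is available only for rational u, with constants depending on u. Vanishing for
  -- rational u passes to real u by continuity, so no uniformity is required.
  have hdense : DenseRange ((↑) : ℚ → ℝ) := Rat.denseRange_cast
  have := hdense.equalizer hcont continuous_const (funext fun u : ℚ ↦ hrat u)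
  exact fun u ↦ congrFun this u

/-- At v = sy/2 the double integral can be sheared so that z runs along sτ/2 + u; integrating in τ
first then gives zero by `integral_half_line_eq_zero`. -/
theorem biCoeff_eq_zero (h : IsStripForm ψ β) {s : ℤ} (hs : s = 1 ∨ s = -1) :
    ∃ A : ℝ, ∀ (n : ℚ) (r : ℤ), e (β - n) = 1 → (n + s / 2 * r : ℝ) < A → ∀ (y v : ℝ), v ≠ 0 →
      |v| < y → biCoeff ψ n r y v = 0 := by
  obtain ⟨A, hA⟩ := h.integral_half_line_eq_zero hs
  refine ⟨A, fun n r hn hlt y v hv hvy ↦ ?_⟩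
  have hy : 0 < y := (abs_nonneg v).trans_lt hvy
  set v' : ℝ := s / 2 * y with hv'
  have hv0 : v' ≠ 0 := half_mul_im_ne_zero hs hy
  have hvy' : |v'| < y := abs_half_mul_im_lt hs hy
  rw [h.biCoeff_eq hn r hv hvy hv0 hvy']
  have h0 := hA n r hn hlt y hy
  have hz : ∀ x u : ℝ, (s : ℂ) / 2 * (x + y * Complex.I) + u =
      ((u + s / 2 * x : ℝ) : ℂ) + v' * Complex.I := fun x u ↦ by
    rw [hv']; push_cast; ring
  have hper : ∀ x : ℝ, Function.Periodic (fun u : ℝ ↦ ψ (x + y * Complex.I) (u + v' * Complex.I) *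
      e (-(r * (u + v' * Complex.I)))) 1 := fun x u ↦ by
    dsimp only
    have e1 : ((u + 1 : ℝ) : ℂ) + v' * Complex.I = u + v' * Complex.I + 1 := by push_cast; ring
    rw [e1, h.per_z _ _ (by rwa [im_add_mul_I, im_add_mul_I])
      (ne_int_of_im_ne_zero (by rwa [im_add_mul_I]))]
    have e2 : -((r : ℂ) * (u + v' * Complex.I + 1)) = -(r * (u + v' * Complex.I)) + (-r : ℤ) := by
      push_cast; ring
    rw [e2, e_add_int]
  have hinner : ∀ x : ℝ, ∫ u in (-1 / 2 : ℝ)..(-1 / 2 + 1),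
      ψ (x + y * Complex.I) (s / 2 * (x + y * Complex.I) + u) *
        e (-((n + s / 2 * r) * (x + y * Complex.I))) * e (-(r * u)) =
      zCoeff ψ r v' (x + y * Complex.I) * e (-(n * (x + y * Complex.I))) := fun x ↦ by
    have h1 := intervalIntegral.integral_comp_add_right (a := (-1 / 2 : ℝ)) (b := -1 / 2 + 1)
      (fun u : ℝ ↦ ψ (x + y * Complex.I) (u + v' * Complex.I) *
        e (-(r * (u + v' * Complex.I)))) (s / 2 * x)
    have h2 := (hper x).intervalIntegral_add_eq (-1 / 2 + s / 2 * x) (-1 / 2)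
    rw [show (-1 / 2 + s / 2 * x + 1 : ℝ) = -1 / 2 + 1 + s / 2 * x by ring] at h2
    rw [zCoeff, ← h2, ← h1, ← intervalIntegral.integral_mul_const]
    refine intervalIntegral.integral_congr fun u _ ↦ ?_
    rw [hz, mul_assoc, mul_assoc, ← e_add, ← e_add, hv']
    congr 2
    push_cast
    ring
  have hswap : ∫ x in (0 : ℝ)..2, zCoeff ψ r v' (x + y * Complex.I) *
      e (-(n * (x + y * Complex.I))) = 0 := by
    simp_rw [← hinner]
    rw [integral_integral_swap_of_continuous]
    · simp_rw [intervalIntegral.integral_mul_const, h0]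
      simp
    · refine Continuous.mul (Continuous.mul ?_ (by fun_prop)) (by fun_prop)
      simp_rw [hz]
      exact (h.continuous_line hv0 hvy').comp
        (g := fun p : ℝ × ℝ ↦ ψ (p.1 + y * Complex.I) (p.2 + v' * Complex.I))
        (f := fun p : ℝ × ℝ ↦ (p.1, p.2 + s / 2 * p.1)) (by fun_prop)
  have hcont : Continuous fun x : ℝ ↦ zCoeff ψ r v' (x + y * Complex.I) *
      e (-(n * (x + y * Complex.I))) := (h.continuous_zCoeff r hv0 hvy').mul (by fun_prop)
  have hperx : Function.Periodic (fun x : ℝ ↦ zCoeff ψ r v' (x + y * Complex.I) *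
      e (-(n * (x + y * Complex.I)))) 1 := fun x ↦ by
    dsimp only
    have e1 : ((x + 1 : ℝ) : ℂ) + y * Complex.I = x + y * Complex.I + 1 := by push_cast; ring
    have e2 : zCoeff ψ r v' (x + y * Complex.I + 1) = e β * zCoeff ψ r v' (x + y * Complex.I) := by
      unfold zCoeff
      rw [← intervalIntegral.integral_const_mul]
      refine intervalIntegral.integral_congr fun u _ ↦ ?_
      rw [h.per_tau _ _ (by rwa [im_add_mul_I, im_add_mul_I])
        (ne_int_of_im_ne_zero (by rwa [im_add_mul_I])), mul_assoc]
    have e3 : -((n : ℂ) * (x + y * Complex.I + 1)) = -(n * (x + y * Complex.I)) + -n := by ring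
    rw [sub_eq_add_neg, e_add] at hn
    rw [e1, e2, e3, e_add]
    linear_combination (zCoeff ψ r v' (x + y * Complex.I) * e (-(n * (x + y * Complex.I)))) * hn
  -- The half-line integral has length 2, hence is twice the coefficient taken over one period.
  have h2 := hperx.intervalIntegral_add_zsmul_eq 2 0 (fun a b ↦ hcont.intervalIntegrable a b)
  have e3 : (0 : ℝ) + (2 : ℤ) • (1 : ℝ) = 2 := by simp
  rw [e3, hswap, zero_add] at h2
  have h3 : (2 : ℤ) • biCoeff ψ n r y v' = 0 := h2.symm
  simpa using h3

/-- The Fourier coefficients with respect to `τ` are Laurent polynomials in `e(z)`. -/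
theorem exists_tauCoeff_eq_sum (h : IsStripForm ψ β) {n : ℚ} (hn : e (β - n) = 1) :
    ∃ (S : Finset ℤ) (d : ℤ → ℂ), ∀ (z : ℂ) (y : ℝ), z.im ≠ 0 → |z.im| < y →
      tauCoeff ψ n y z = ∑ r ∈ S, d r * e (r * z) := by
  obtain ⟨A, hA⟩ := h.biCoeff_eq_zero (s := 1) (Or.inl rfl)
  obtain ⟨B, hB⟩ := h.biCoeff_eq_zero (s := -1) (Or.inr rfl)
  -- A nonzero coefficient needs n + r/2 ≥ A and n - r/2 ≥ B, which bounds r from both sides. The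
  -- heights 1 and 1/2 are arbitrary admissible choices, by `biCoeff_eq`.
  refine ⟨Finset.Icc ⌊2 * (A - n)⌋ ⌈2 * (n - B)⌉, fun r ↦ biCoeff ψ n r 1 (1 / 2), fun z y hz hy ↦ ?_⟩
  set S := Finset.Icc ⌊2 * (A - n)⌋ ⌈2 * (n - B)⌉ with hS
  set g : ℝ → ℂ := fun u ↦ tauCoeff ψ n y (u + z.im * Complex.I) with hg
  have hper : Function.Periodic g 1 := fun u ↦ by
    simp only [hg, tauCoeff]
    refine intervalIntegral.integral_congr fun x _ ↦ ?_
    have e1 : ((u + 1 : ℝ) : ℂ) + z.im * Complex.I = u + z.im * Complex.I + 1 := by push_cast; ring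
    rw [e1, h.per_z _ _ (by rwa [im_add_mul_I, im_add_mul_I])
      (ne_int_of_im_ne_zero (by rwa [im_add_mul_I]))]
  have hzeroS : ∀ k ∉ S, biCoeff ψ n k y z.im = 0 := fun k hk ↦ by
    rw [hS, Finset.mem_Icc, not_and_or, not_le, not_le] at hk
    rcases hk with hk | hk
    · refine hA n k hn ?_ y _ hz hy
      rw [Int.lt_floor_iff] at hk
      have : ((k : ℝ) + 1) ≤ 2 * (A - n) := by exact_mod_cast hk
      push_cast
      linarith
    · refine hB n k hn ?_ y _ hz hy
      rw [Int.ceil_lt_iff] at hk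
      push_cast
      have : 2 * (n - B) ≤ (k : ℝ) - 1 := by exact_mod_cast hk
      linarith
  have hcoef : ∀ k : ℤ, ∫ u in (0 : ℝ)..1, g u * e (-(k * u)) =
      biCoeff ψ n k y z.im * e (k * (z.im * Complex.I)) := fun k ↦ by
    have hp2 : Function.Periodic (fun u : ℝ ↦ g u * e (-(k * u))) 1 := fun u ↦ by
      have e2 : -((k : ℂ) * ((u + 1 : ℝ) : ℂ)) = -(k * u) + (-k : ℤ) := by push_cast; ring
      simp only []
      rw [hper u, e2, e_add_int]
    have h2 := hp2.intervalIntegral_add_eq 0 (-1 / 2)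
    rw [zero_add] at h2
    rw [h2, h.biCoeff_eq_integral_tauCoeff n k hz hy, ← intervalIntegral.integral_mul_const]
    refine intervalIntegral.integral_congr fun u _ ↦ ?_
    rw [mul_assoc, ← e_add]
    simp only [hg]
    congr 2
    ring
  have := eq_sum_fourier (h.continuous_tauCoeff n hz hy) hper S
    (fun k hk ↦ by rw [hcoef k, hzeroS k hk, zero_mul]) z.re
  simp only [Complex.re_add_im] at this
  rw [this]
  refine Finset.sum_congr rfl fun k _ ↦ ?_
  rw [hcoef k, mul_assoc, ← e_add, h.biCoeff_eq hn k hz hy (v₂ := 1 / 2) (y₂ := 1) (by norm_num)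
    (by rw [abs_of_pos] <;> norm_num), ← mul_add]
  congr 3
  rw [add_comm]
  exact Complex.re_add_im z

end IsStripForm

/-! ### Jacobi forms on the strip -/

theorem not_mem_lattice {τ z : ℂ} (hz : |z.im| < τ.im) (hu : ∀ u : ℤ, z ≠ u) : z ∉ lattice τ := by
  rintro ⟨l, u, h⟩
  have him : z.im = l * τ.im := by
    rw [h]
    simp
  have hτ : 0 < τ.im := (abs_nonneg _).trans_lt hz
  rw [him, abs_mul, abs_of_pos hτ, mul_lt_iff_lt_one_left hτ] at hz
  have hl : |l| < 1 := by exact_mod_cast hz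
  rw [Int.abs_lt_one_iff] at hl
  exact hu u (by rw [h, hl]; simp)

theorem coe_ofComplex {τ : ℂ} (hτ : 0 < τ.im) : (ofComplex τ : ℂ) = τ := by
  rw [ofComplex_apply_of_im_pos hτ]

/-- The function `(e(z) - 1) ^ ν φ(τ, z)`, extended to complex `τ`. -/
def regularized (ν : ℤ) (φ : ℍ → ℂ → ℂ) (τ z : ℂ) : ℂ := (e z - 1) ^ ν * φ (ofComplex τ) z

theorem e_sub_one_ne_zero {z : ℂ} (hu : ∀ u : ℤ, z ≠ u) : e z - 1 ≠ 0 := by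
  rw [sub_ne_zero, Ne, e_eq_one_iff]
  rintro ⟨u, h⟩
  exact hu u h

/-- `regularized` uses e(z) - 1 because it has period 1, whereas `thetaFactor` changes sign under z
↦ z + 1. The two differ by a nowhere vanishing factor. -/
theorem e_sub_one_eq (z : ℂ) : e z - 1 = e (z / 2) * thetaFactor z := by
  rw [thetaFactor, mul_sub, ← e_add, ← e_add, neg_div, add_neg_cancel, e_zero, add_halves]

/-- Away from the real line ‖e(z)‖ is at most 1/2 or at least 2, so ‖e(z) - 1‖ and its inverse obey
the same bound, which covers both signs of ν. -/
theorem norm_e_sub_one_zpow_le (ν : ℤ) {z : ℂ} (hz : 1 ≤ |z.im|) :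
    ‖(e z - 1) ^ ν‖ ≤ (2 * Real.exp (2 * Real.pi * |z.im|)) ^ |ν| := by
  set E := Real.exp (2 * Real.pi * |z.im|) with hE
  have hE1 : 2 ≤ E := by
    have h1 : 1 + 1 ≤ Real.exp 1 := Real.add_one_le_exp 1
    have h2 : Real.exp 1 ≤ E := by
      apply Real.exp_le_exp.2
      nlinarith [Real.pi_gt_three]
    linarith
  have hup : ‖e z - 1‖ ≤ 2 * E := by
    refine (norm_sub_le _ _).trans ?_
    have : ‖e z‖ ≤ E := by
      rw [norm_e, hE]
      apply Real.exp_le_exp.2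
      nlinarith [Real.pi_pos, neg_abs_le z.im]
    rw [norm_one]
    linarith
  have hlow : (2 * E)⁻¹ ≤ ‖e z - 1‖ := by
    have h4 : (2 * E)⁻¹ ≤ 1 / 2 := by
      rw [inv_le_comm₀ (by positivity) (by norm_num)]
      linarith
    refine h4.trans ?_
    rcases abs_cases z.im with ⟨h, h'⟩ | ⟨h, h'⟩
    · have : ‖e z‖ = E⁻¹ := by rw [norm_e, hE, h, Real.exp_neg]
      have h2 := norm_sub_norm_le 1 (e z)
      rw [norm_sub_rev, norm_one, this] at h2
      have h3 : E⁻¹ ≤ 2⁻¹ := inv_anti₀ (by norm_num) hE1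
      linarith
    · have : ‖e z‖ = E := by rw [norm_e, hE, h]; ring_nf
      have h2 := norm_sub_norm_le (e z) 1
      rw [norm_one, this] at h2
      linarith
  have hpos : 0 < ‖e z - 1‖ := lt_of_lt_of_le (by positivity) hlow
  rw [norm_zpow]
  rcases abs_cases ν with ⟨h, h'⟩ | ⟨h, h'⟩
  · rw [h]
    exact zpow_le_zpow_left₀ h' hpos.le hup
  · rw [h, ← inv_zpow']
    have hinv : ‖e z - 1‖⁻¹ ≤ 2 * E := by
      rw [inv_le_comm₀ hpos (by positivity)]
      exact hlow
    have := zpow_le_zpow_left₀ (n := -ν) (by omega) (inv_nonneg.2 hpos.le) hinv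
    rwa [inv_zpow', neg_neg, ← h, h, ← inv_zpow'] at this

section

variable {Γ : Subgroup Mp1Z} {χ : Γ →* ℂˣ} {w : ℤ} {m : ℂ} {φ : ℍ → ℂ → ℂ}

theorem IsJacobiForm.add_int (hφ : IsJacobiForm Γ χ w m φ) (τ : ℍ) {z : ℂ} (hz : z ∉ lattice τ)
    (u : ℤ) : φ τ (z + u) = φ τ z := by
  have := hφ.heisenberg_eq 0 u 0 τ z hz
  simpa [heisenbergSlash, e_zero] using this

theorem IsJacobiForm.add_one_left (hφ : IsJacobiForm Γ χ w m φ) (hT : Mp1Z.T ∈ Γ) {β : ℚ}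
    (hβ : (χ ⟨Mp1Z.T, hT⟩ : ℂ) = e β) {τ z : ℂ} (hτ : 0 < τ.im) (hz : z ∉ lattice τ) :
    φ (ofComplex (τ + 1)) z = e β * φ (ofComplex τ) z := by
  have h1 := hφ.slash_eq ⟨Mp1Z.T, hT⟩ (ofComplex τ) z (by rwa [coe_ofComplex hτ])
  rw [hβ] at h1
  rw [← h1]
  have h2 : (Mp1Z.T.mat • ofComplex τ : ℍ) = ofComplex (τ + 1) := by
    apply UpperHalfPlane.ext
    rw [coe_ofComplex (by simpa using hτ), coe_specialLinearGroup_apply, coe_ofComplex hτ]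
    simp [Mp1Z.T, ModularGroup.T]
  simp only [jacobiSlash]
  rw [h2]
  simp [Mp1Z.T, Mp1Z.den, ModularGroup.T, e_zero]

theorem IsJacobiForm.growth_half (hφ : IsJacobiForm Γ χ w m φ) (ν : ℤ) {s : ℤ}
    (hs : s = 1 ∨ s = -1) : ∃ a : ℝ, ∀ u : ℚ, ∃ C Y : ℝ, ∀ τ : ℂ, 0 < τ.im → Y ≤ τ.im →
    ‖regularized ν φ τ (s / 2 * τ + u)‖ ≤ C * Real.exp (a * τ.im) := by
  obtain ⟨a, ha⟩ := hφ.growth 1 (s / 2)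
  -- On these lines |Im z| = Im τ / 2, so the factor (e(z) - 1)^ν costs at most π|ν| in the
  -- exponent. The half-integer s/2 is never an integer, hence every rational u is allowed.
  refine ⟨a + Real.pi * |ν|, fun u ↦ ?_⟩
  have hnl : ¬ ∃ l' u' : ℤ, (s / 2 : ℚ) = l' ∧ u = u' := by
    rintro ⟨l', -, h, -⟩
    rw [div_eq_iff (by norm_num)] at h
    have : s = l' * 2 := by exact_mod_cast h
    omega
  obtain ⟨C, hC⟩ := (ha u hnl).bound
  rw [atImInfty, eventually_comap] at hC
  obtain ⟨Y, hY⟩ := eventually_atTop.1 hC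
  refine ⟨2 ^ |ν| * C, max Y 2, fun τ hτ hYτ ↦ ?_⟩
  have h1 := hY τ.im ((le_max_left _ _).trans hYτ) ⟨τ, hτ⟩ rfl
  have him : ((s : ℂ) / 2 * τ + u).im = s / 2 * τ.im := by
    have := IsStripForm.half_mul_im s τ u
    rwa [Complex.ofReal_ratCast] at this
  have habs : |((s : ℂ) / 2 * τ + u).im| = τ.im / 2 := by
    rw [him, abs_mul, abs_of_pos hτ]
    rcases hs with rfl | rfl <;> norm_num <;> ring
  have h2 := norm_e_sub_one_zpow_le ν (z := (s : ℂ) / 2 * τ + u)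
    (by rw [habs]; linarith [(le_max_right _ _).trans hYτ])
  rw [habs] at h2
  have h3 : jacobiSlash w m φ 1 ⟨τ, hτ⟩ ((s / 2 : ℚ) * (⟨τ, hτ⟩ : ℍ) + u) =
      φ (ofComplex τ) (s / 2 * τ + u) := by
    rw [ofComplex_apply_of_im_pos hτ]
    simp [jacobiSlash, Mp1Z.den, e_zero]
  rw [h3, Real.norm_of_nonneg (Real.exp_pos _).le] at h1
  rw [regularized, norm_mul]
  calc _ ≤ (2 * Real.exp (2 * Real.pi * (τ.im / 2))) ^ |ν| * (C * Real.exp (a * τ.im)) := by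
        gcongr
        exact h1
    _ = 2 ^ |ν| * C * Real.exp ((a + Real.pi * |ν|) * τ.im) := by
        have : Real.exp (2 * Real.pi * (τ.im / 2)) ^ |ν| = Real.exp (Real.pi * |ν| * τ.im) := by
          rw [← Real.rpow_intCast, ← Real.exp_mul]
          ring_nf
        rw [mul_zpow, this, add_mul, Real.exp_add]
        ring

theorem IsJacobiForm.isStripForm (hφ : IsJacobiForm Γ χ w m φ) (hT : Mp1Z.T ∈ Γ) {β : ℚ}
    (hβ : (χ ⟨Mp1Z.T, hT⟩ : ℂ) = e β) {ν : ℤ} {f : ℍ → ℂ} (hf : SpecializesTo φ ν f) :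
    IsStripForm (regularized ν φ) β where
  holo τ z hz hu := by
    have hopen : IsOpen {q : ℂ × ℂ | |q.2.im| < q.1.im ∧ q.2 ∈ (Set.range ((↑) : ℤ → ℂ))ᶜ} :=
      (isOpen_lt (f := fun q : ℂ × ℂ ↦ |q.2.im|) (g := fun q ↦ q.1.im) (by fun_prop)
        (by fun_prop)).inter
        (Complex.isClosed_range_intCast.isOpen_compl.preimage continuous_snd)
    have hmem : (τ, z) ∈ {q : ℂ × ℂ | |q.2.im| < q.1.im ∧ q.2 ∈ (Set.range ((↑) : ℤ → ℂ))ᶜ} := by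
      refine ⟨hz, ?_⟩
      rintro ⟨u, h⟩
      exact hu u h.symm
    have h1 : DifferentiableAt ℂ (fun q : ℂ × ℂ ↦ φ (ofComplex q.1) q.2) (τ, z) := by
      refine hφ.holo.differentiableAt (Filter.mem_of_superset (hopen.mem_nhds hmem) ?_)
      rintro q ⟨hq, hq'⟩
      exact ⟨(abs_nonneg _).trans_lt hq, not_mem_lattice hq fun u h ↦ hq' ⟨u, h.symm⟩⟩
    refine DifferentiableAt.mul ?_ h1
    refine DifferentiableAt.zpow ?_ (Or.inl (e_sub_one_ne_zero hu))
    exact (DifferentiableAt.comp (g := e) (τ, z) (differentiable_e z)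
      differentiableAt_snd).sub_const 1
  per_z τ z hz hu := by
    have hτ : 0 < τ.im := (abs_nonneg _).trans_lt hz
    have := hφ.add_int (ofComplex τ) (z := z)
      (by rw [coe_ofComplex hτ]; exact not_mem_lattice hz hu) 1
    rw [Int.cast_one] at this
    rw [regularized, regularized, e_add_one, this]
  per_tau τ z hz hu := by
    have hτ : 0 < τ.im := (abs_nonneg _).trans_lt hz
    rw [regularized, regularized, hφ.add_one_left hT hβ hτ (not_mem_lattice hz hu)]
    ring
  removable τ hτ := by
    refine ⟨e (0 / 2) ^ ν * f (ofComplex τ), ?_⟩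
    have h1 : regularized ν φ τ =
        fun z ↦ e (z / 2) ^ ν * (thetaFactor z ^ ν * φ (ofComplex τ) z) := by
      funext z
      rw [regularized, e_sub_one_eq, mul_zpow, mul_assoc]
    rw [h1]
    refine Tendsto.mul ?_ (hf.1 _)
    have hc : ContinuousAt (fun z : ℂ ↦ e (z / 2) ^ ν) 0 :=
      ContinuousAt.zpow₀ (by fun_prop) ν (Or.inl (e_ne_zero _))
    exact hc.tendsto.mono_left nhdsWithin_le_nhds
  growth s hs := hφ.growth_half ν hs

/-- The leading Fourier coefficients as integrals. -/
theorem leadingCoeff_eq (hφ : IsJacobiForm Γ χ w m φ) (hT : Mp1Z.T ∈ Γ) {β : ℚ}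
    (hβ : (χ ⟨Mp1Z.T, hT⟩ : ℂ) = e β) {ν : ℤ} {f : ℍ → ℂ} (hf : SpecializesTo φ ν f)
    {c : ℚ → ℚ → ℂ} (hc : IsFourierExpansion φ c) (n : ℚ) (z : ℍ) {y : ℝ} (hy : z.im < y) :
    leadingCoeff c ν n z =
      if e (β - n) = 1 then e (z / 2) ^ (-ν) * tauCoeff (regularized ν φ) n y z else 0 := by
  have hψ := hφ.isStripForm hT hβ hf
  obtain ⟨ε, hε, hsum⟩ := hc
  have hz0 : (z : ℂ).im ≠ 0 := z.im_pos.ne'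
  have habs : |(z : ℂ).im| = z.im := abs_of_pos z.im_pos
  -- High enough for z to lie both in the strip and in the region where the Fourier expansion is
  -- valid; the height is changed to the given y at the end by `tauCoeff_eq`.
  set y₀ : ℝ := max z.im (z.im / ε) + 1 with hy₀
  have hzy : z.im < y₀ := by linarith [le_max_left z.im (z.im / ε)]
  have hzy' : z.im < ε * y₀ := by
    have : z.im / ε < y₀ := by linarith [le_max_right z.im (z.im / ε)]
    rwa [div_lt_iff₀' hε] at this
  have hpos : ∀ x : ℝ, 0 < ((x : ℂ) + y₀ * Complex.I).im := fun x ↦ by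
    rw [im_add_mul_I]; exact z.im_pos.trans hzy
  set G : ℝ → ℂ := fun x ↦ φ (ofComplex (x + y₀ * Complex.I)) z with hG
  have hGsum : ∀ x : ℝ, HasSum (fun p : ℚ × ℚ ↦ c p.1 p.2 *
      e (p.1 * (x + y₀ * Complex.I) + p.2 * z)) (G x) := fun x ↦ by
    have h1 := hsum (ofComplex (x + y₀ * Complex.I)) z z.im_pos
      (by rw [← coe_im, coe_ofComplex (hpos x)]; simpa using hzy')
    rwa [coe_ofComplex (hpos x)] at h1
  have hsm := (hGsum 0).summable
  have hterm : ∀ (x : ℝ) (n r : ℚ), c n r * e (n * (x + y₀ * Complex.I) + r * z) =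
      c n r * e (r * z) * (e (n * (y₀ * Complex.I)) * e (n * x)) := fun x n r ↦ by
    rw [mul_assoc, ← e_add, ← e_add]
    ring_nf
  have hfib : ∀ n : ℚ, Summable fun r : ℚ ↦ c n r * e (r * z) := fun n ↦ by
    have h1 := hsm.prod_factor n
    simp only [hterm] at h1
    exact (summable_mul_right_iff (mul_ne_zero (e_ne_zero _) (e_ne_zero _))).1 h1
  set b : ℚ → ℂ := fun n ↦ (∑' r : ℚ, c n r * e (r * z)) * e (n * (y₀ * Complex.I)) with hb
  have hbsum : Summable fun n ↦ ‖b n‖ := by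
    refine Summable.of_nonneg_of_le (fun _ ↦ norm_nonneg _) (fun n ↦ ?_) hsm.norm.prod
    have h1 := hsm.norm.prod_factor n
    have h2 := norm_tsum_le_tsum_norm h1
    refine le_trans (le_of_eq ?_) h2
    simp only [hterm]
    rw [tsum_mul_right]
    simp [hb, e_zero]
  have hbG : ∀ x : ℝ, HasSum (fun n : ℚ ↦ b n * e (n * x)) (G x) := fun x ↦ by
    refine (hGsum x).prod_fiberwise fun n ↦ ?_
    simp only [hterm]
    have := (hfib n).hasSum.mul_right (e (n * (y₀ * Complex.I)) * e (n * x))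
    simpa only [hb, mul_assoc] using this
  have hper : ∀ x : ℝ, G (x + 1) = e β * G x := fun x ↦ by
    have e1 : ((x + 1 : ℝ) : ℂ) + y₀ * Complex.I = x + y₀ * Complex.I + 1 := by push_cast; ring
    simp only [hG]
    rw [e1]
    refine hφ.add_one_left hT hβ (hpos x) (not_mem_lattice ?_ (ne_int_of_im_ne_zero hz0))
    rw [habs, im_add_mul_I]
    exact hzy
  have hcoef := coeff_of_quasiperiodic hbsum hbG hper n
  have htsum : ∑' r : ℚ, c n r * e (r * z) = b n * e (-(n * (y₀ * Complex.I))) := by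
    simp only [hb]
    rw [mul_assoc, ← e_add]
    simp [e_zero]
  rw [leadingCoeff, htsum, hcoef]
  split_ifs with h
  · rw [hψ.tauCoeff_eq h (ne_int_of_im_ne_zero hz0) (habs.trans_lt hy) (habs.trans_lt hzy),
      tauCoeff, ← intervalIntegral.integral_mul_const, ← intervalIntegral.integral_const_mul,
      ← intervalIntegral.integral_const_mul]
    refine intervalIntegral.integral_congr fun x _ ↦ ?_
    simp only [regularized, hG]
    rw [e_sub_one_eq, mul_zpow, zpow_neg]
    have h1 : e (z / 2) ^ ν ≠ 0 := zpow_ne_zero _ (e_ne_zero _)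
    have h2 : e (-(n * (x + y₀ * Complex.I))) =
        e (-(n * x)) * e (-(n * (y₀ * Complex.I))) := by rw [← e_add]; ring_nf
    rw [h2]
    field_simp
  · simp

end

/-! ### Cyclotomic divisibility and vanishing at torsion points -/

theorem evalE_mul (P Q : ℂ[T;T⁻¹]) (w : ℂ) : evalE (P * Q) w = evalE P w * evalE Q w := by
  simp [evalE]

theorem evalE_T (k : ℤ) (w : ℂ) : evalE (LaurentPolynomial.T k) w = e (k * w) := by
  simp [evalE, e_int_mul]

theorem evalE_aeval (p : Polynomial ℂ) (N : ℤ) (w : ℂ) :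
    evalE (Polynomial.aeval (LaurentPolynomial.T N : ℂ[T;T⁻¹]) p) w = p.eval (e (N * w)) := by
  induction p using Polynomial.induction_on' with
  | add p q hp hq => simp only [evalE, map_add, Polynomial.eval_add] at *; rw [hp, hq]
  | monomial k a =>
    rw [Polynomial.aeval_monomial, evalE_mul, LaurentPolynomial.T_pow, evalE_T,
      Polynomial.eval_monomial, ← e_nat_mul]
    congr 1
    · simp [evalE]
    · push_cast; ring_nf

theorem continuous_evalE (P : ℂ[T;T⁻¹]) : Continuous (evalE P) := by
  induction P using LaurentPolynomial.induction_on' with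
  | add p q hp hq =>
    have : evalE (p + q) = fun w ↦ evalE p w + evalE q w := by
      funext w
      simp [evalE]
    rw [this]
    exact hp.add hq
  | C_mul_T n a =>
    have : evalE (LaurentPolynomial.C a * LaurentPolynomial.T n) = fun w ↦ a * e (n * w) := by
      funext w
      rw [evalE_mul, evalE_T]
      simp [evalE]
    rw [this]
    fun_prop

/-- Leading coefficients are functions on the upper half plane, while torsion points are real; this
limit joins the two. Clamping v to [-1/2, 1/2] keeps z in the strip for every v, giving a globally
continuous integrand. -/
theorem IsStripForm.tendsto_tauCoeff {ψ : ℂ → ℂ → ℂ} {β : ℚ} (h : IsStripForm ψ β) (n : ℚ) {t : ℝ}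
    (ht : ∀ u : ℤ, t ≠ u) :
    Tendsto (fun v : ℝ ↦ tauCoeff ψ n 1 (t + v * Complex.I)) (𝓝[>] 0) (𝓝 (tauCoeff ψ n 1 t)) := by
  set cl : ℝ → ℝ := fun v ↦ max (-1 / 2) (min v (1 / 2)) with hcl
  have hclc : Continuous cl := by fun_prop
  have hcl1 : ∀ v, |cl v| < 1 := fun v ↦ by
    rw [abs_lt]
    refine ⟨lt_of_lt_of_le (by norm_num) (le_max_left _ _), max_lt (by norm_num) ?_⟩
    exact lt_of_le_of_lt (min_le_right _ _) (by norm_num)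
  have hcont : Continuous fun v : ℝ ↦ tauCoeff ψ n 1 (t + cl v * Complex.I) := by
    unfold tauCoeff
    refine intervalIntegral.continuous_parametric_intervalIntegral_of_continuous'
      (f := fun (v x : ℝ) ↦ ψ (x + (1 : ℝ) * Complex.I) (t + cl v * Complex.I) *
        e (-(n * (x + (1 : ℝ) * Complex.I)))) ?_ _ _
    refine Continuous.mul ?_ (by fun_prop)
    refine h.continuous_comp (f := fun p : ℝ × ℝ ↦ (p.2 : ℂ) + (1 : ℝ) * Complex.I)
      (g := fun p : ℝ × ℝ ↦ (t : ℂ) + cl p.1 * Complex.I) (by fun_prop) (by fun_prop)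
      (fun p ↦ by rw [im_add_mul_I, im_add_mul_I]; exact hcl1 _) (fun p u hu ↦ ?_)
    have := congrArg Complex.re hu
    rw [re_add_mul_I] at this
    exact ht u (by simpa using this)
  have h0 : cl 0 = 0 := by simp [hcl]; norm_num
  have h1 := (hcont.tendsto 0).mono_left (nhdsWithin_le_nhds (s := Set.Ioi 0))
  rw [h0] at h1
  simp only [Complex.ofReal_zero, zero_mul, add_zero] at h1
  refine h1.congr' ?_
  have hmem : Set.Ioo (0 : ℝ) (1 / 2) ∈ 𝓝[>] (0 : ℝ) := Ioo_mem_nhdsGT (by norm_num)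
  filter_upwards [hmem] with v hv
  have : cl v = v := by
    simp only [hcl]
    rw [min_eq_left hv.2.le, max_eq_right (by linarith [hv.1])]
  rw [this]

theorem div_ne_int {ℓ : ℕ} (hℓ : ℓ.Prime) {j : ℤ} (hj : ¬ (ℓ : ℤ) ∣ j) (u : ℤ) :
    (j / ℓ : ℝ) ≠ u := by
  intro h
  rw [div_eq_iff (by exact_mod_cast hℓ.ne_zero)] at h
  exact hj ⟨u, by rw [mul_comm]; exact_mod_cast h⟩

theorem isPrimitiveRoot_e {ℓ : ℕ} (hℓ : ℓ.Prime) {j : ℤ} (hj : ¬ (ℓ : ℤ) ∣ j) :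
    IsPrimitiveRoot (e (j / ℓ)) ℓ := by
  have hℓ0 : (ℓ : ℂ) ≠ 0 := by exact_mod_cast hℓ.ne_zero
  refine IsPrimitiveRoot.iff_orderOf.2 (orderOf_eq_prime_iff (hp := ⟨hℓ⟩) |>.2 ⟨?_, ?_⟩)
  · rw [← e_nat_mul, mul_div_cancel₀ _ hℓ0, e_int]
  · rw [Ne, e_eq_one_iff]
    rintro ⟨u, hu⟩
    refine div_ne_int hℓ hj u ?_
    exact_mod_cast hu

section

variable {Γ : Subgroup Mp1Z} {χ : Γ →* ℂˣ} {w : ℤ} {m : ℂ} {φ : ℍ → ℂ → ℂ}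

/-- For ℓ ∤ j the number e(j/ℓ) is a primitive ℓ-th root of unity, so Φ_ℓ(e(z)) vanishes at z = j/ℓ;
the conclusion follows by approaching j/ℓ vertically. -/
theorem tauCoeff_eq_zero_of_cyclotomicDvd (hφ : IsJacobiForm Γ χ w m φ) (hT : Mp1Z.T ∈ Γ) {β : ℚ}
    (hβ : (χ ⟨Mp1Z.T, hT⟩ : ℂ) = e β) {ν : ℤ} {f : ℍ → ℂ} (hf : SpecializesTo φ ν f)
    {c : ℚ → ℚ → ℂ} (hc : IsFourierExpansion φ c) {n : ℚ} (hn : e (β - n) = 1) {ℓ : ℕ}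
    (hℓ : ℓ.Prime) (hdvd : CyclotomicDvd ℓ (leadingCoeff c ν n)) {j : ℤ} (hj : ¬ (ℓ : ℤ) ∣ j) :
    tauCoeff (regularized ν φ) n 1 (j / ℓ) = 0 := by
  obtain ⟨N, hN, P, hP, R, rfl⟩ := hdvd
  have hN0 : (N : ℂ) ≠ 0 := by exact_mod_cast hN.ne'
  have h1 := (hφ.isStripForm hT hβ hf).tendsto_tauCoeff n (div_ne_int hℓ hj)
  have hcoe : ((j / ℓ : ℝ) : ℂ) = j / ℓ := by push_cast; rfl
  rw [hcoe] at h1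
  set F : ℂ → ℂ := fun z ↦ e (z / 2) ^ ν * ((Polynomial.cyclotomic ℓ ℂ).eval (e z) *
    evalE R (z / N)) with hF
  have hFc : Continuous F := by
    refine Continuous.mul ?_ (Continuous.mul ?_ ?_)
    · exact Continuous.zpow₀ (by fun_prop) ν fun z ↦ Or.inl (e_ne_zero _)
    · exact (Polynomial.continuous _).comp continuous_e
    · exact (continuous_evalE R).comp (by fun_prop)
  have h2 : Tendsto (fun v : ℝ ↦ F (j / ℓ + v * Complex.I)) (𝓝[>] 0) (𝓝 (F (j / ℓ))) := by
    have hg : Continuous fun v : ℝ ↦ F (j / ℓ + v * Complex.I) := hFc.comp (by fun_prop)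
    simpa using (hg.tendsto 0).mono_left (nhdsWithin_le_nhds (s := Set.Ioi 0))
  have hF0 : F (j / ℓ) = 0 := by
    have : NeZero (ℓ : ℂ) := ⟨by exact_mod_cast hℓ.ne_zero⟩
    have := Polynomial.isRoot_cyclotomic_iff.2 (isPrimitiveRoot_e hℓ hj)
    simp only [hF]
    rw [this.eq_zero]
    ring
  rw [← hF0]
  refine tendsto_nhds_unique (h1.congr' ?_) h2
  have hmem : Set.Ioo (0 : ℝ) 1 ∈ 𝓝[>] (0 : ℝ) := Ioo_mem_nhdsGT (by norm_num)
  filter_upwards [hmem] with v hv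
  have him : ((j : ℂ) / ℓ + v * Complex.I).im = v := by rw [← hcoe, im_add_mul_I]
  have h3 := leadingCoeff_eq hφ hT hβ hf hc n ⟨j / ℓ + v * Complex.I, by rw [him]; exact hv.1⟩
    (y := 1) (by rw [← coe_im]; exact him.trans_lt hv.2)
  rw [hP, if_pos hn, evalE_mul, evalE_aeval] at h3
  simp only [Int.cast_natCast, mul_div_cancel₀ _ hN0] at h3
  simp only [hF]
  rw [h3, zpow_neg, ← mul_assoc, mul_inv_cancel₀ (zpow_ne_zero _ (e_ne_zero _)), one_mul]

/-- Multiplied by a power of e(z), the coefficient becomes a polynomial in e(z) vanishing at all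
primitive ℓ-th roots of unity, hence divisible by Φ_ℓ, whose roots are simple. -/
theorem cyclotomicDvd_of_tauCoeff_eq_zero (hφ : IsJacobiForm Γ χ w m φ) (hT : Mp1Z.T ∈ Γ) {β : ℚ}
    (hβ : (χ ⟨Mp1Z.T, hT⟩ : ℂ) = e β) {ν : ℤ} {f : ℍ → ℂ} (hf : SpecializesTo φ ν f)
    {c : ℚ → ℚ → ℂ} (hc : IsFourierExpansion φ c) {n : ℚ} {ℓ : ℕ} (hℓ : ℓ.Prime)
    (h0 : e (β - n) = 1 → ∀ j : ℤ, ¬ (ℓ : ℤ) ∣ j →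
      tauCoeff (regularized ν φ) n 1 (j / ℓ) = 0) :
    CyclotomicDvd ℓ (leadingCoeff c ν n) := by
  by_cases hn : e (β - n) = 1
  swap
  · refine ⟨1, one_pos, 0, fun z ↦ ?_, dvd_zero _⟩
    rw [leadingCoeff_eq hφ hT hβ hf hc n z (lt_add_one _), if_neg hn]
    simp [evalE]
  have hψ := hφ.isStripForm hT hβ hf
  obtain ⟨S, d, hd⟩ := hψ.exists_tauCoeff_eq_sum hn
  obtain ⟨k, hk⟩ : ∃ k : ℕ, ∀ r ∈ S, 0 ≤ r + k := by
    refine ⟨∑ r ∈ S, r.natAbs, fun r hr ↦ ?_⟩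
    have := Finset.single_le_sum (f := fun r : ℤ ↦ r.natAbs) (fun _ _ ↦ Nat.zero_le _) hr
    omega
  set p : Polynomial ℂ := ∑ r ∈ S, Polynomial.monomial (r + k).toNat (d r) with hp
  have hpe : ∀ z : ℂ, p.eval (e z) = e (k * z) * ∑ r ∈ S, d r * e (r * z) := fun z ↦ by
    rw [hp, Polynomial.eval_finsetSum, Finset.mul_sum]
    refine Finset.sum_congr rfl fun r hr ↦ ?_
    have h1 : (((r + k).toNat : ℕ) : ℂ) = r + k := by
      have := Int.toNat_of_nonneg (hk r hr)
      exact_mod_cast congrArg (Int.cast : ℤ → ℂ) this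
    rw [Polynomial.eval_monomial, ← e_nat_mul, h1, add_mul, e_add]
    ring
  have hroot : ∀ j : ℤ, ¬ (ℓ : ℤ) ∣ j → p.eval (e (j / ℓ)) = 0 := fun j hj ↦ by
    have h1 := hψ.tendsto_tauCoeff n (div_ne_int hℓ hj)
    have hcoe : ((j / ℓ : ℝ) : ℂ) = j / ℓ := by push_cast; rfl
    rw [hcoe, h0 hn j hj] at h1
    have h2 : Tendsto (fun v : ℝ ↦ ∑ r ∈ S, d r * e (r * (j / ℓ + v * Complex.I))) (𝓝[>] 0)
        (𝓝 (∑ r ∈ S, d r * e (r * (j / ℓ)))) := by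
      have hg : Continuous fun v : ℝ ↦ ∑ r ∈ S, d r * e (r * (j / ℓ + v * Complex.I)) := by
        fun_prop
      simpa using (hg.tendsto 0).mono_left (nhdsWithin_le_nhds (s := Set.Ioi 0))
    have h3 : ∑ r ∈ S, d r * e (r * (j / ℓ)) = 0 := by
      refine tendsto_nhds_unique h2 (h1.congr' ?_)
      have hmem : Set.Ioo (0 : ℝ) 1 ∈ 𝓝[>] (0 : ℝ) := Ioo_mem_nhdsGT (by norm_num)
      filter_upwards [hmem] with v hv
      have him : ((j : ℂ) / ℓ + v * Complex.I).im = v := by rw [← hcoe, im_add_mul_I]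
      exact hd _ _ (by rw [him]; exact hv.1.ne') (by rw [him, abs_of_pos hv.1]; exact hv.2)
    rw [hpe, h3, mul_zero]
  have hcyc : Polynomial.cyclotomic ℓ ℂ ∣ p := by
    have hprim := Complex.isPrimitiveRoot_exp ℓ hℓ.ne_zero
    rw [Polynomial.cyclotomic_eq_prod_X_sub_primitiveRoots hprim]
    refine Finset.prod_dvd_of_coprime
      (fun x _ y _ hxy ↦ Polynomial.pairwise_coprime_X_sub_C Function.injective_id hxy)
      fun ζ hζ ↦ ?_
    rw [Polynomial.dvd_iff_isRoot]
    have hζ' := (mem_primitiveRoots hℓ.pos).1 hζ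
    obtain ⟨i, -, hcop, hi⟩ := (Complex.isPrimitiveRoot_iff ζ ℓ hℓ.ne_zero).1 hζ'
    have h1 : ζ = e ((i : ℤ) / ℓ) := by rw [← hi, e]; push_cast; ring_nf
    rw [Polynomial.IsRoot, h1]
    refine hroot i fun hdv ↦ ?_
    have : ℓ ∣ i := by exact_mod_cast hdv
    exact hℓ.one_lt.ne' (Nat.dvd_one.1 (hcop ▸ Nat.dvd_gcd this dvd_rfl))
  -- N = 2 accommodates e(z/2)^(-ν) when ν is odd; in the variable e(z/2), the exponent -2k undoes
  -- the shift by e(kz).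
  refine ⟨2, two_pos, Polynomial.aeval (LaurentPolynomial.T ((2 : ℕ) : ℤ) : ℂ[T;T⁻¹]) p *
    LaurentPolynomial.T (-2 * k - ν), fun z ↦ ?_, Dvd.dvd.mul_right (map_dvd _ hcyc) _⟩
  have hy : z.im < z.im + 1 := lt_add_one _
  rw [leadingCoeff_eq hφ hT hβ hf hc n z hy, if_pos hn, hd z (z.im + 1) z.im_pos.ne'
    ((abs_of_pos z.im_pos).trans_lt hy), evalE_mul, evalE_aeval, evalE_T]
  have e1 : (((2 : ℕ) : ℤ) : ℂ) * ((z : ℂ) / (2 : ℕ)) = z := by push_cast; ring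
  rw [e1, hpe]
  have e2 : e (((-2 * k - ν : ℤ) : ℂ) * ((z : ℂ) / (2 : ℕ))) =
      e (-(k * z)) * e (z / 2) ^ (-ν) := by
    rw [← e_int_mul, ← e_add]
    push_cast
    ring_nf
  rw [e2, e_neg]
  have h1 := mul_inv_cancel₀ (e_ne_zero (k * z))
  linear_combination (-(e (z / 2) ^ (-ν) * ∑ r ∈ S, d r * e (r * z))) * h1

end

/-! ### Extracting Fourier coefficients in residue classes -/

namespace IsStripForm

variable {ψ : ℂ → ℂ → ℂ} {β : ℚ}

theorem continuous_real (h : IsStripForm ψ β) {t : ℝ} (ht : ∀ u : ℤ, t ≠ u) {y : ℝ} (hy : 0 < y)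
    (s : ℝ) : Continuous fun x : ℝ ↦ ψ (x + y * Complex.I + s) t :=
  h.continuous_comp (f := fun x : ℝ ↦ (x : ℂ) + y * Complex.I + s) (g := fun _ ↦ (t : ℂ))
    (by fun_prop) (by fun_prop) (fun x ↦ by simpa using hy)
    (fun x u hu ↦ ht u (by exact_mod_cast hu))

theorem per_real (h : IsStripForm ψ β) {t : ℝ} (ht : ∀ u : ℤ, t ≠ u) {τ : ℂ} (hτ : 0 < τ.im) :
    ψ (τ + 1) t = e β * ψ τ t :=
  h.per_tau τ t (by simpa using hτ) fun u hu ↦ ht u (by exact_mod_cast hu)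

theorem integral_translate (h : IsStripForm ψ β) {t : ℝ} (ht : ∀ u : ℤ, t ≠ u) {n : ℚ}
    (hn : e (β - n) = 1) {y : ℝ} (hy : 0 < y) (s : ℝ) :
    ∫ x in (0 : ℝ)..1, ψ (x + y * Complex.I + s) t * e (-(n * (x + y * Complex.I))) =
      e (n * s) * tauCoeff ψ n y t := by
  have hper : Function.Periodic
      (fun x : ℝ ↦ ψ (x + y * Complex.I) t * e (-(n * (x + y * Complex.I)))) 1 := fun x ↦ by
    have e1 : ((x + 1 : ℝ) : ℂ) + y * Complex.I = x + y * Complex.I + 1 := by push_cast; ring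
    have e3 : -((n : ℂ) * (x + y * Complex.I + 1)) = -(n * (x + y * Complex.I)) + -n := by ring
    rw [sub_eq_add_neg, e_add] at hn
    dsimp only
    rw [e1, h.per_real ht (by rwa [im_add_mul_I]), e3, e_add]
    linear_combination (ψ (x + y * Complex.I) t * e (-(n * (x + y * Complex.I)))) * hn
  have h1 := hper.intervalIntegral_add_eq s 0
  have h2 := intervalIntegral.integral_comp_add_right (a := (0 : ℝ)) (b := 1)
    (fun x : ℝ ↦ ψ (x + y * Complex.I) t * e (-(n * (x + y * Complex.I)))) s
  rw [zero_add] at h1 h2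
  rw [add_comm s 1] at h1
  rw [tauCoeff, ← h1, ← h2, ← intervalIntegral.integral_const_mul]
  refine intervalIntegral.integral_congr fun x _ ↦ ?_
  have e1 : ((x + s : ℝ) : ℂ) + y * Complex.I = x + y * Complex.I + s := by push_cast; ring
  have e2 : e (-(n * (x + y * Complex.I))) =
      e (n * s) * e (-(n * (x + y * Complex.I + s))) := by rw [← e_add]; ring_nf
  rw [e1, e2]
  ring

theorem integral_sum_translate (h : IsStripForm ψ β) {t : ℝ} (ht : ∀ u : ℤ, t ≠ u) {n : ℚ}
    (hn : e (β - n) = 1) {y : ℝ} (hy : 0 < y) (M : ℕ) (b : ℚ) :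
    ∫ x in (0 : ℝ)..1, (∑ k ∈ Finset.range M, e (-(k * b / M)) *
      ψ (x + y * Complex.I + (k / M : ℝ)) t) * e (-(n * (x + y * Complex.I))) =
      (∑ k ∈ Finset.range M, e ((n - b) / M) ^ k) * tauCoeff ψ n y t := by
  simp_rw [Finset.sum_mul]
  rw [intervalIntegral.integral_finsetSum]
  · refine Finset.sum_congr rfl fun k _ ↦ ?_
    simp_rw [mul_assoc]
    rw [intervalIntegral.integral_const_mul, h.integral_translate ht hn hy, ← mul_assoc, ← e_add,
      ← e_nat_mul]
    congr 2
    push_cast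
    ring
  · intro k _
    exact ((continuous_const.mul (h.continuous_real ht hy _)).mul
      (by fun_prop)).intervalIntegrable _ _

/-- If the Fourier coefficients of index in `M ℤ + β` vanish, then so does the combination of
translates that extracts them. -/
theorem sum_translate_eq_zero (h : IsStripForm ψ β) {t : ℝ} (ht : ∀ u : ℤ, t ≠ u) {M : ℕ}
    (hM : 0 < M)
    (h0 : ∀ n : ℚ, (∃ j : ℤ, n = M * j + β) → tauCoeff ψ n 1 t = 0) {τ : ℂ} (hτ : 0 < τ.im) :
    ∑ k ∈ Finset.range M, e (-(k * β / M)) * ψ (τ + (k / M : ℝ)) t = 0 := by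
  have hM0 : (M : ℂ) ≠ 0 := by exact_mod_cast hM.ne'
  set y := τ.im with hy
  -- The factor e(-βτ) makes the sum periodic, so it vanishes once all its Fourier coefficients do.
  -- The k-th one is a geometric sum in e(k/M) times the coefficient of ψ at β + k: the former is
  -- zero unless M ∣ k, and then the latter is zero by `h0`.
  set g : ℝ → ℂ := fun x ↦ (∑ k ∈ Finset.range M, e (-(k * β / M)) *
      ψ (x + y * Complex.I + (k / M : ℝ)) t) * e (-(β * (x + y * Complex.I))) with hg
  have hgc : Continuous g := by
    refine Continuous.mul ?_ (by fun_prop)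
    exact continuous_finsetSum _ fun k _ ↦ continuous_const.mul (h.continuous_real ht hτ _)
  have hgp : Function.Periodic g 1 := fun x ↦ by
    have e3 : -((β : ℂ) * (x + y * Complex.I + 1)) = -(β * (x + y * Complex.I)) + -β := by ring
    have e2 : ((x + 1 : ℝ) : ℂ) + y * Complex.I = x + y * Complex.I + 1 := by push_cast; ring
    have e4 : ∀ k : ℕ, ψ (x + y * Complex.I + 1 + (k / M : ℝ)) t =
        e β * ψ (x + y * Complex.I + (k / M : ℝ)) t := fun k ↦ by
      rw [add_right_comm, h.per_real ht (by simpa using hτ)]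
    simp only [hg]
    rw [e2, e3, e_add, e_neg β]
    simp_rw [e4, mul_left_comm _ (e (β : ℂ))]
    rw [← Finset.mul_sum, mul_mul_mul_comm, mul_comm (e (β : ℂ)), mul_mul_mul_comm, mul_comm,
      mul_inv_cancel₀ (e_ne_zero _), one_mul, mul_comm]
  have hcoef : ∀ k ∉ (∅ : Finset ℤ), ∫ x in (0 : ℝ)..1, g x * e (-(k * x)) = 0 := fun k _ ↦ by
    set n : ℚ := β + k with hn
    have hnβ : e (β - n) = 1 := by
      have := e_int (-k)
      rw [hn]
      push_cast at this ⊢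
      rwa [sub_add_cancel_left]
    have hz : ∀ x : ℝ, g x * e (-(k * x)) = e (k * (y * Complex.I)) *
        ((∑ k ∈ Finset.range M, e (-(k * β / M)) *
      ψ (x + y * Complex.I + (k / M : ℝ)) t) * e (-(n * (x + y * Complex.I)))) := fun x ↦ by
      have e1 : e (-(n * (x + y * Complex.I))) * e (k * (y * Complex.I)) =
          e (-(β * (x + y * Complex.I))) * e (-(k * x)) := by
        rw [← e_add, ← e_add, hn]
        push_cast
        ring_nf
      simp only [hg]
      rw [mul_assoc, ← e1]
      ring
    simp_rw [hz]
    rw [intervalIntegral.integral_const_mul, h.integral_sum_translate ht hnβ hτ]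
    have hnk : ((n : ℂ) - β) / M = k / M := by rw [hn]; push_cast; ring
    rw [hnk]
    by_cases hk : e ((k : ℂ) / M) = 1
    · obtain ⟨j, hj⟩ := (e_eq_one_iff _).1 hk
      rw [div_eq_iff hM0] at hj
      have hj' : k = j * M := by exact_mod_cast hj
      have h1 : tauCoeff ψ n y t = 0 := by
        rw [h.tauCoeff_eq hnβ (fun u hu ↦ ht u (by exact_mod_cast hu)) (y₂ := 1) (by simpa using hτ)
          (by simp)]
        refine h0 n ⟨j, ?_⟩
        rw [hn, hj']
        push_cast
        ring
      rw [h1]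
      ring
    · have hgeom := geom_sum_eq hk M
      rw [← e_nat_mul, mul_div_cancel₀ _ hM0, e_int, sub_self, zero_div] at hgeom
      rw [hgeom]
      ring
  have h1 := eq_sum_fourier hgc hgp ∅ hcoef τ.re
  simp only [hg, Finset.sum_empty, hy, Complex.re_add_im] at h1
  exact (mul_eq_zero.1 h1).resolve_right (e_ne_zero _)

/-- For n in Mℤ + b all terms of the geometric sum equal 1, so M times the coefficient is zero. Here
b need not be congruent to β modulo 1. -/
theorem tauCoeff_eq_zero_of_sum_translate (h : IsStripForm ψ β) {t : ℝ} (ht : ∀ u : ℤ, t ≠ u)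
    {M : ℕ} (hM : 0 < M) {b : ℚ}
    (h0 : ∀ τ : ℂ, 0 < τ.im → ∑ k ∈ Finset.range M, e (-(k * b / M)) * ψ (τ + (k / M : ℝ)) t = 0)
    {n : ℚ} (hn : e (β - n) = 1) (hnb : ∃ j : ℤ, n = M * j + b) : tauCoeff ψ n 1 t = 0 := by
  have hM0 : (M : ℂ) ≠ 0 := by exact_mod_cast hM.ne'
  have h1 := h.integral_sum_translate ht hn one_pos M b
  have h2 : ∀ x : ℝ, ∑ k ∈ Finset.range M, e (-(k * b / M)) *
      ψ (x + (1 : ℝ) * Complex.I + (k / M : ℝ)) t = 0 := fun x ↦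
    h0 _ (by rw [im_add_mul_I]; exact one_pos)
  simp_rw [h2] at h1
  obtain ⟨j, rfl⟩ := hnb
  have h3 : (((M * j + b : ℚ) : ℂ) - b) / M = j := by
    push_cast
    field_simp
    ring
  rw [h3, e_int] at h1
  simpa [hM0] using h1.symm

end IsStripForm

/-- Multiplication by a unit permutes ℤ/M. -/
theorem sum_range_mul_of_periodic {M : ℕ} (hM : 0 < M) {K : ℤ → ℂ} (hK : ∀ h, K (h + M) = K h)
    {u : ℤ} (hu : IsCoprime u M) :
    ∑ h ∈ Finset.range M, K (u * h) = ∑ h ∈ Finset.range M, K h := by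
  have : NeZero M := ⟨hM.ne'⟩
  have hKc : ∀ x y : ℤ, (x : ZMod M) = y → K x = K y := fun x y hxy ↦ by
    rw [ZMod.intCast_eq_intCast_iff_dvd_sub] at hxy
    obtain ⟨q, hq⟩ := hxy
    have h1 : Function.Periodic K (M : ℤ) := hK
    have h2 := h1.int_mul q x
    rw [← h2]
    congr 1
    linear_combination -hq
  have hsum : ∀ F : ℤ → ℂ, ∑ h ∈ Finset.range M, F h = ∑ x : ZMod M, F (x.val : ℤ) := fun F ↦ by
    refine Finset.sum_bij' (fun h _ ↦ (h : ZMod M)) (fun x _ ↦ x.val) ?_ ?_ ?_ ?_ ?_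
    · simp
    · intro x _; exact Finset.mem_range.2 (ZMod.val_lt x)
    · intro h hh; exact ZMod.val_cast_of_lt (Finset.mem_range.1 hh)
    · intro x _; exact ZMod.natCast_zmod_val x
    · intro h hh; rw [ZMod.val_cast_of_lt (Finset.mem_range.1 hh)]
  have hunit : IsUnit (u : ZMod M) := by
    obtain ⟨p, q, hpq⟩ := hu
    refine IsUnit.of_mul_eq_one (p : ZMod M) ?_
    have := congrArg (Int.cast : ℤ → ZMod M) hpq
    push_cast at this
    rw [ZMod.natCast_self, mul_zero, add_zero] at this
    rw [mul_comm]; exact this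
  obtain ⟨v, hv⟩ := hunit
  rw [hsum (fun h ↦ K (u * h)), hsum]
  refine Eq.trans ?_ (Equiv.sum_comp (Units.mulLeft v) fun x : ZMod M ↦ K (x.val : ℤ))
  refine Finset.sum_congr rfl fun x _ ↦ hKc _ _ ?_
  push_cast
  rw [ZMod.natCast_zmod_val, ZMod.natCast_zmod_val, Units.mulLeft_apply, hv]

/-! ### The action of `Γ_M^Δ(χ)` -/

theorem Mp1Z.T_zpow (k : ℤ) :
    (Mp1Z.T ^ k).mat = ModularGroup.T ^ k ∧ ∀ τ, (Mp1Z.T ^ k).root τ = 1 := by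
  have hr : ∀ τ, Mp1Z.T.root τ = 1 := fun _ ↦ rfl
  have hm : Mp1Z.T.mat = ModularGroup.T := rfl
  induction k using Int.induction_on with
  | zero => simp
  | succ k ih =>
    rw [zpow_add_one, zpow_add_one]
    refine ⟨by rw [Mp1Z.mul_mat, ih.1, hm], fun τ ↦ ?_⟩
    rw [Mp1Z.mul_root, ih.2, hr, one_mul]
  | pred k ih =>
    rw [zpow_sub_one, zpow_sub_one]
    refine ⟨by rw [Mp1Z.mul_mat, ih.1, Mp1Z.inv_mat, hm], fun τ ↦ ?_⟩
    rw [Mp1Z.mul_root, ih.2, Mp1Z.inv_root, hr, inv_one, one_mul]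

theorem coe_T_zpow_smul (k : ℤ) (τ : ℍ) : ((ModularGroup.T ^ k • τ : ℍ) : ℂ) = τ + k := by
  rw [coe_specialLinearGroup_apply]
  simp [ModularGroup.coe_T_zpow]

theorem twist_mat (γ : Mp1Z) (h : ℤ) :
    (twist γ h).mat = ModularGroup.T ^ (γ.mat 0 0 ^ 2 * h) * γ.mat * ModularGroup.T ^ (-h) := by
  rw [twist, Mp1Z.mul_mat, Mp1Z.mul_mat, (Mp1Z.T_zpow _).1, (Mp1Z.T_zpow _).1]

theorem twist_root (γ : Mp1Z) (h : ℤ) (τ : ℍ) :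
    (twist γ h).root (ModularGroup.T ^ h • τ) = γ.root τ := by
  rw [twist, Mp1Z.mul_root, Mp1Z.mul_root, (Mp1Z.T_zpow _).2, (Mp1Z.T_zpow _).2,
    (Mp1Z.T_zpow _).1, ← mul_smul, ← zpow_add, neg_add_cancel, zpow_zero, one_smul, one_mul,
    mul_one]

theorem twist_zero (γ : Mp1Z) : twist γ 0 = γ := by simp [twist]

theorem twist_mat_one_zero (γ : Mp1Z) (h : ℤ) : (twist γ h).mat 1 0 = γ.mat 1 0 := by
  rw [twist_mat]
  simp [ModularGroup.coe_T_zpow, Matrix.mul_apply, Matrix.vecMul, dotProduct, Fin.sum_univ_two]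

theorem twist_mat_one_one (γ : Mp1Z) (h : ℤ) :
    (twist γ h).mat 1 1 = γ.mat 1 1 - γ.mat 1 0 * h := by
  rw [twist_mat]
  simp [ModularGroup.coe_T_zpow, Matrix.mul_apply, Matrix.vecMul, dotProduct, Fin.sum_univ_two]
  ring

theorem det_eq_one (g : SL(2, ℤ)) : g 0 0 * g 1 1 - g 0 1 * g 1 0 = 1 := by
  rw [← Matrix.det_fin_two, g.2]

section

variable {Γ : Subgroup Mp1Z} {χ : Γ →* ℂˣ} {w : ℤ} {m : ℂ} {φ : ℍ → ℂ → ℂ}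

/-- The values of `φ` at translates `(τ + h) / M` and torsion points are related to the values at
the points `(γ τ + a² h) / M` by a factor that does not depend on `h`. -/
theorem exists_torsion_factor (hφ : IsJacobiForm Γ χ w m φ) {M : ℕ+} {ℓ : ℕ} (hℓ : ℓ.Prime)
    {γ : Mp1Z} (hγ : γ ∈ gammaDeltaChar M Γ χ) (hγℓ : γ ∈ mpGamma0 ℓ) (τ : ℍ) {j : ℤ}
    (hj : ¬ (ℓ : ℤ) ∣ γ.mat 1 1 * j) :
    ∃ D : ℂ, ∀ h : ℤ, φ (ofComplex ((τ + h) / M)) (γ.mat 1 1 * j / ℓ) =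
      D * φ (ofComplex (((γ.mat • τ : ℍ) + (γ.mat 0 0 ^ 2 * h : ℤ)) / M)) (j / ℓ) := by
  obtain ⟨⟨-, htw, -⟩, hchi⟩ := hγ
  have hM0 : (M : ℂ) ≠ 0 := by exact_mod_cast M.ne_zero
  have hℓ0 : (ℓ : ℂ) ≠ 0 := by exact_mod_cast hℓ.ne_zero
  obtain ⟨c₁, hc₁⟩ := hγℓ
  -- The case h = 0 puts γ itself in the conjugate group, so that χ̃(γ) makes sense.
  obtain ⟨y, hy, hyγ⟩ := htw 0
  rw [twist_zero] at hyγ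
  have hden0 := Mp1Z.den_ne_zero γ.mat τ
  set den : ℂ := (γ.mat 1 0 : ℂ) * τ + (γ.mat 1 1 : ℂ) with hden
  set z : ℂ := den * (j / ℓ) with hz
  set d : ℤ := γ.mat 1 1 with hd
  refine ⟨e (m * (c₁ ^ 2 * j ^ 2 * M * τ + 2 * (c₁ * j * M) * (d * j / ℓ))) *
    ((chiTilde M Γ χ ⟨y, hy⟩ : ℂ)⁻¹ * (γ.root τ ^ (-w) *
      e (m * (-((M * γ.mat 1 0 : ℤ) : ℂ) * z ^ 2 / den)))), fun h ↦ ?_⟩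
  obtain ⟨x, hx, hxγ⟩ := htw h
  have hχ := hchi h ⟨x, hx⟩ ⟨y, hy⟩ hxγ hyγ
  have hxγ' : x.1 = twist γ h := hxγ
  have hpos : 0 < (((τ : ℂ) + h) / M).im := by
    rw [show (M : ℂ) = ((M : ℕ) : ℂ) from rfl, Complex.div_natCast_im]
    exact div_pos (by simpa using τ.im_pos) (by exact_mod_cast M.pos)
  set τ' : ℍ := ofComplex ((τ + h) / M) with hτ'
  have hτ'c : (τ' : ℂ) = (τ + h) / M := coe_ofComplex hpos
  have hscale : scale M τ' = ModularGroup.T ^ h • τ := by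
    apply UpperHalfPlane.ext
    rw [coe_scale, coe_T_zpow_smul, hτ'c]
    field_simp
  set g : Mp1Z := iotaHecke M x with hg
  have hgroot : g.root τ' = γ.root τ := by
    change x.1.root (scale M τ') = _
    rw [hscale, hxγ', twist_root]
  have hgc : g.mat 1 0 = M * γ.mat 1 0 := by
    change (M : ℤ) * x.1.mat 1 0 = _
    rw [hxγ', twist_mat_one_zero]
  have hgden : g.den τ' = den := by
    have h1 : g.mat 1 1 = γ.mat 1 1 - γ.mat 1 0 * h := by
      change x.1.mat 1 1 = _
      rw [hxγ', twist_mat_one_one]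
    rw [Mp1Z.den, hgc, h1, hτ'c, hden]
    push_cast
    field_simp
    ring
  have hgsmul : g.mat • τ' = ofComplex (((γ.mat • τ : ℍ) + (γ.mat 0 0 ^ 2 * h : ℤ)) / M) := by
    have h1 : scale M (g.mat • τ') = x.1.mat • scale M τ' :=
      scale_heckeMat_smul M x.1.mat (mem_mpGammaUpper0.1 x.2) τ'
    rw [hscale, hxγ', twist_mat, ← mul_smul, mul_assoc, ← zpow_add, neg_add_cancel, zpow_zero,
      mul_one, mul_smul] at h1
    have h2 := congrArg ((↑) : ℍ → ℂ) h1
    rw [coe_scale, coe_T_zpow_smul] at h2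
    rw [← h2, mul_div_cancel_left₀ _ hM0, ofComplex_apply]
  -- Since c = ℓc₁ and τ = Mτ' - h, the point (cτ + d) j/ℓ differs from dj/ℓ by a lattice vector for
  -- τ'.
  have hzt : z = d * j / ℓ + ((c₁ * j * M : ℤ) : ℂ) * τ' + ((-(c₁ * j * h) : ℤ) : ℂ) := by
    rw [hz, hden, hc₁, hτ'c]
    push_cast
    field_simp
    ring
  have hτ'pos := τ'.im_pos
  have hd' : (((d * j : ℤ) / ℓ : ℝ) : ℂ) = d * j / ℓ := by push_cast; rfl
  have htors : (d * j / ℓ : ℂ) ∉ lattice τ' := by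
    rw [← hd']
    refine not_mem_lattice (by simpa using hτ'pos) fun u hu ↦ ?_
    exact div_ne_int hℓ hj u (by exact_mod_cast hu)
  have hzl : z ∉ lattice τ' := by
    rintro ⟨l, u, hlu⟩
    refine htors ⟨l - c₁ * j * M, u + c₁ * j * h, ?_⟩
    rw [hzt] at hlu
    push_cast at hlu ⊢
    linear_combination hlu
  -- With λ = c₁jM one has λ²τ' = c₁²j²Mτ + c₁²j²Mh. The central entry cancels the last term, so the
  -- Heisenberg factor is independent of h.
  have hheis := hφ.heisenberg_eq (c₁ * j * M) (-(c₁ * j * h)) (-(c₁ ^ 2 * j ^ 2 * M * h)) τ'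
    (d * j / ℓ) htors
  rw [heisenbergSlash, ← hzt] at hheis
  have hslash := hφ.slash_eq ⟨g, hx⟩ τ' z hzl
  have hχ' : χ ⟨g, hx⟩ = chiTilde M Γ χ ⟨y, hy⟩ := hχ
  rw [jacobiSlash] at hslash
  simp only [] at hslash
  rw [hgroot, hgc, hgden, hgsmul, hχ', hz, mul_div_cancel_left₀ _ hden0, ← hz] at hslash
  have hχ0 : (chiTilde M Γ χ ⟨y, hy⟩ : ℂ) ≠ 0 := Units.ne_zero _
  have e1 : ((((c₁ * j * M : ℤ) : ℂ) ^ 2 * τ' + 2 * ((c₁ * j * M : ℤ) : ℂ) * (d * j / ℓ) +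
      ((-(c₁ ^ 2 * j ^ 2 * M * h) : ℤ) : ℂ))) =
      c₁ ^ 2 * j ^ 2 * M * τ + 2 * (c₁ * j * M) * (d * j / ℓ) := by
    rw [hτ'c]
    push_cast
    field_simp
    ring
  rw [← hheis, e1, mul_assoc (e _), mul_assoc (_⁻¹), hslash, inv_mul_cancel_left₀ hχ0]

theorem tauCoeff_eq_zero_of_mem_gammaDeltaChar (hφ : IsJacobiForm Γ χ w m φ) (hT : Mp1Z.T ∈ Γ)
    {β : ℚ} (hβ : (χ ⟨Mp1Z.T, hT⟩ : ℂ) = e β) {ν : ℤ} {f : ℍ → ℂ} (hf : SpecializesTo φ ν f)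
    {M : ℕ+} {ℓ : ℕ} (hℓ : ℓ.Prime) {γ : Mp1Z} (hγ : γ ∈ gammaDeltaChar M Γ χ)
    (hγℓ : γ ∈ mpGamma0 ℓ)
    (h0 : ∀ n : ℚ, (∃ j : ℤ, n = (M : ℕ) * j + β) → ∀ j : ℤ, ¬ (ℓ : ℤ) ∣ j →
      tauCoeff (regularized ν φ) n 1 (j / ℓ) = 0) {n : ℚ} (hn : e (β - n) = 1)
    (hnb : ∃ j : ℤ, n = (M : ℕ) * j + (γ.mat 0 0 : ℚ) ^ 2 * β) {j : ℤ} (hj : ¬ (ℓ : ℤ) ∣ j) :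
    tauCoeff (regularized ν φ) n 1 (j / ℓ) = 0 := by
  have hψ := hφ.isStripForm hT hβ hf
  have hM0 : ((M : ℕ) : ℂ) ≠ 0 := by exact_mod_cast M.ne_zero
  have hMr : (0 : ℝ) < (M : ℕ) := by exact_mod_cast M.pos
  have hℓ0 : (ℓ : ℂ) ≠ 0 := by exact_mod_cast hℓ.ne_zero
  have hdet := det_eq_one γ.mat
  obtain ⟨c₁, hc₁⟩ := id hγℓ
  obtain ⟨c₂, hc₂⟩ := hγ.1.2.2.2
  set a := γ.mat 0 0 with ha
  set b := γ.mat 0 1 with hb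
  set d := γ.mat 1 1 with hd
  have hcoe : ∀ i : ℤ, ((i / ℓ : ℝ) : ℂ) = i / ℓ := fun i ↦ by push_cast; rfl
  -- Since ad ≡ 1 modulo ℓ, the torsion point j/ℓ for the new progression corresponds to aj/ℓ for
  -- the old one.
  have hdj : d * (a * j) = j + b * c₁ * j * ℓ := by
    rw [hc₁] at hdet
    linear_combination j * hdet
  have hdaj : ¬ (ℓ : ℤ) ∣ d * (a * j) := by
    rw [hdj]
    exact fun h ↦ hj ((dvd_add_left (Dvd.intro_left _ rfl)).1 h)
  have haj : ¬ (ℓ : ℤ) ∣ a * j := fun h ↦ hdaj (h.mul_left d)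
  rw [← hcoe]
  refine hψ.tauCoeff_eq_zero_of_sum_translate (div_ne_int hℓ hj) M.pos
    (b := (a : ℚ) ^ 2 * β) (fun σ hσ ↦ ?_) hn hnb
  set τ : ℍ := scale M ⟨σ, hσ⟩ with hτ
  obtain ⟨D, hD⟩ := exists_torsion_factor hφ hℓ hγ hγℓ τ (j := a * j) hdaj
  set K : ℤ → ℂ := fun h ↦ e (-(h * β / (M : ℕ))) *
    φ (ofComplex (((γ.mat • τ : ℍ) + h) / M)) ((a * j : ℤ) / ℓ) with hK
  have himK : ∀ h : ℤ, 0 < ((((γ.mat • τ : ℍ) : ℂ) + h) / M).im := fun h ↦ by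
    rw [show (M : ℂ) = ((M : ℕ) : ℂ) from rfl, Complex.div_natCast_im]
    exact div_pos (by simpa using (γ.mat • τ).im_pos) hMr
  -- The factor e(β) from φ(τ + 1, z) = e(β) φ(τ, z) cancels the e(-β) from the weight.
  have hKper : ∀ h, K (h + (M : ℕ)) = K h := fun h ↦ by
    simp only [hK]
    have e1 : (((γ.mat • τ : ℍ) : ℂ) + ((h + (M : ℕ) : ℤ) : ℂ)) / M =
        (((γ.mat • τ : ℍ) : ℂ) + h) / M + 1 := by
      push_cast
      field_simp
      ring
    have e2 : -(((h + (M : ℕ) : ℤ) : ℂ) * β / (M : ℕ)) = -(h * β / (M : ℕ)) + -β := by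
      push_cast
      field_simp
      ring
    rw [e1, e2, e_add, e_neg β, hφ.add_one_left hT hβ (himK h)]
    · have := e_ne_zero β
      field_simp
    · rw [← hcoe]
      refine not_mem_lattice (by simpa using himK h) fun u hu ↦ ?_
      exact div_ne_int hℓ haj u (by exact_mod_cast hu)
  have hKsum : ∑ h ∈ Finset.range M, K h = 0 := by
    have h1 := hψ.sum_translate_eq_zero (div_ne_int hℓ haj) M.pos
      (fun n hn ↦ by rw [hcoe]; exact h0 n hn _ haj) (himK 0)
    have h2 : (e (((a * j : ℤ) / ℓ : ℝ) : ℂ) - 1) ^ ν ≠ 0 := by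
      refine zpow_ne_zero _ (e_sub_one_ne_zero fun u hu ↦ ?_)
      exact div_ne_int hℓ haj u (by exact_mod_cast hu)
    simp only [regularized, mul_left_comm _ ((e (((a * j : ℤ) / ℓ : ℝ) : ℂ) - 1) ^ ν)] at h1
    rw [← Finset.mul_sum] at h1
    have h3 := (mul_eq_zero.1 h1).resolve_left h2
    rw [← h3]
    refine Finset.sum_congr rfl fun h _ ↦ ?_
    simp only [hK]
    rw [hcoe]
    congr 4
    push_cast
    field_simp
    ring
  -- Diagonality modulo M gives ad ≡ 1 modulo M.
  have hcop : IsCoprime (a ^ 2) ((M : ℕ) : ℤ) := by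
    refine IsCoprime.pow_left ⟨d, -(b * c₂), ?_⟩
    rw [hc₂] at hdet
    rw [← hdet]
    ring
  have hKa := sum_range_mul_of_periodic M.pos hKper hcop
  rw [hKsum] at hKa
  have hterm : ∀ k : ℕ, e (-(k * ((a : ℚ) ^ 2 * β : ℚ) / (M : ℕ))) *
      regularized ν φ (σ + (k / (M : ℕ) : ℝ)) (j / ℓ : ℝ) =
      (e (j / ℓ : ℝ) - 1) ^ ν * D * K (a ^ 2 * k) := fun k ↦ by
    have h1 := hD k
    have e1 : ((τ : ℂ) + (k : ℤ)) / M = σ + (k / (M : ℕ) : ℝ) := by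
      rw [hτ, coe_scale]
      push_cast
      field_simp
    have e2 : (d : ℂ) * (a * j : ℤ) / ℓ = (j / ℓ : ℝ) + (b * c₁ * j : ℤ) := by
      have := congrArg (Int.cast : ℤ → ℂ) hdj
      push_cast at this ⊢
      rw [this]
      field_simp
    have hpos : 0 < ((σ : ℂ) + (k / (M : ℕ) : ℝ)).im := by simpa using hσ
    rw [e1, e2, hφ.add_int] at h1
    · rw [regularized, h1]
      simp only [hK]
      have e3 : -((k : ℂ) * ((a : ℚ) ^ 2 * β : ℚ) / (M : ℕ)) =
          -(((a ^ 2 * k : ℤ) : ℂ) * β / (M : ℕ)) := by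
        push_cast
        ring
      rw [e3]
      ring
    · rw [coe_ofComplex hpos]
      refine not_mem_lattice (by simpa using hpos) fun u hu ↦ ?_
      exact div_ne_int hℓ hj u (by exact_mod_cast hu)
  rw [Finset.sum_congr rfl fun k _ ↦ hterm k, ← Finset.mul_sum, hKa, mul_zero]

end

end JacobiRC

end

theorem mainTheorem3
    (Γ : Subgroup JacobiRC.Mp1Z) (hΓ : Γ.FiniteIndex) (χ : Γ →* ℂˣ)
    (hT : JacobiRC.Mp1Z.T ∈ Γ) (β : ℚ) (hβ : (χ ⟨JacobiRC.Mp1Z.T, hT⟩ : ℂ) = JacobiRC.e β)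
    (w : ℤ) (m : ℂ) (φ : ℍ → ℂ → ℂ) (hφ : JacobiRC.IsJacobiForm Γ χ w m φ)
    (K : IntermediateField ℚ ℂ) [NumberField K] (ℓ : ℕ) (hℓ : ℓ.Prime)
    (𝔩 : Ideal (𝓞 K)) (h𝔩 : 𝔩.IsPrime) (hℓ𝔩 : (ℓ : 𝓞 K) ∈ 𝔩) (M : ℕ+)
    (hexp : JacobiRC.ExplainsCongruence Γ χ w K 𝔩 ℓ M β φ)
    (γ : JacobiRC.Mp1Z) (hγ : γ ∈ JacobiRC.gammaDeltaChar M Γ χ ∩ JacobiRC.mpGamma0 ℓ) :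
    JacobiRC.ExplainsCongruence Γ χ w K 𝔩 ℓ M ((γ.mat 0 0 : ℚ) ^ 2 * β) φ := by
  obtain ⟨f, ν, c, hfm, hf, hc, hint, hcyc⟩ := hexp
  refine ⟨f, ν, c, hfm, hf, hc, hint, fun n hn ↦ ?_⟩
  -- Indices n not congruent to β modulo 1 have zero leading coefficient, so n ≡ β may be assumed;
  -- on Mℤ + β this congruence is automatic.
  refine JacobiRC.cyclotomicDvd_of_tauCoeff_eq_zero hφ hT hβ hf hc hℓ fun hnβ j hj ↦ ?_
  refine JacobiRC.tauCoeff_eq_zero_of_mem_gammaDeltaChar hφ hT hβ hf hℓ hγ.1 hγ.2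
    (fun n' hn' j' hj' ↦ ?_) hnβ hn hj
  refine JacobiRC.tauCoeff_eq_zero_of_cyclotomicDvd hφ hT hβ hf hc ?_ hℓ (hcyc n' hn') hj'
  obtain ⟨k, rfl⟩ := hn'
  have h1 := JacobiRC.e_int (-((M : ℕ) * k))
  push_cast at h1 ⊢
  rwa [sub_add_cancel_right]
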